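/- Let $a_n=\sqrt{(n+1)/2}$ for $n\ge 0$, and let $J$ be the Hermite Jacobi operator in $\ell^2(\mathbb Z_+)$ (complex sequences), $(Jf)_n=a_{n-1}f_{n-1}+a_nf_{n+1}$ with $a_{-1}=0$, on the domain of all $f\in\ell^2(\mathbb Z_+)$ with $Jf\in\ell^2(\mathbb Z_+)$. Let $H_n$ be the orthonormal Hermite polynomials, determined by $a_{n-1}H_{n-1}(\lambda)+a_nH_{n+1}(\lambda)=\lambda H_n(\lambda)$, $H_{-1}=0$, $H_0=1$, and let $\Phi:\ell^2(\mathbb Z_+)\to L^2(\mathbb R)$ be the isometry $$(\Phi f)(\lambda)=\pi^{-1/4}\sum_{n=0}^\infty e^{-\lambda^2/2}H_n(\lambda)f_n$$ (the series converges in $L^2(\mathbb R)$). For $g\in C_0^\infty(\mathbb R)$ let $\hat g(x)=(2\pi)^{-1/2}\int_{\mathbb R}e^{-ix\lambda}g(\lambda)\,d\lambda$, and define $$(U(t)g)_n=i^{\mp n}(2n+1)^{-1/4}\,\hat g\bigl(t\mp\sqrt{2n+1}\bigr),\qquad \pm t>0,\quad n\ge 0.$$ Then $J$ generates exactly one strongly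 continuous unitary group $e^{-iJt}$ in $\ell^2(\mathbb Z_+)$, and for every $f\in\ell^2(\mathbb Z_+)$ with $\Phi f\in C_0^\infty(\mathbb R)$, the sequences $U(t)\Phi f$, $t\neq 0$, belong to $\ell^2(\mathbb Z_+)$ and $$\lim_{t\to\pm\infty}\bigl\|e^{-iJt}f-U(t)\Phi f\bigr\|_{\ell^2(\mathbb Z_+)}=0.$$ -/

import Mathlib

open MeasureTheory Filter Topology
open scoped ENNReal

noncomputable section

/-- The Hilbert space `ℓ²(ℤ₊)` of complex sequences. -/
abbrev EllTwo : Type := lp (fun _ : ℕ => ℂ) 2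

/-- The Hilbert space `L²(ℝ)` of complex functions, with Lebesgue measure. -/
abbrev LTwo : Type := Lp ℂ 2 (volume : Measure ℝ)

/-- The formal Jacobi operator
`(J f)_n = a_{n-1} f_{n-1} + b_n f_n + a_n f_{n+1}`, with `a_{-1} = 0`. -/
def jacobiSeq (a b : ℕ → ℝ) (f : ℕ → ℂ) : ℕ → ℂ
  | 0 => (b 0 : ℂ) * f 0 + (a 0 : ℂ) * f 1
  | n + 1 => (a n : ℂ) * f n + (b (n + 1) : ℂ) * f (n + 1) + (a (n + 1) : ℂ) * f (n + 2)

theorem jacobiSeq_add (a b : ℕ → ℝ) (f g : ℕ → ℂ) :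
    jacobiSeq a b (f + g) = jacobiSeq a b f + jacobiSeq a b g := by
  funext n
  cases n <;> simp [jacobiSeq] <;> ring

theorem jacobiSeq_smul (a b : ℕ → ℝ) (c : ℂ) (f : ℕ → ℂ) :
    jacobiSeq a b (c • f) = c • jacobiSeq a b f := by
  funext n
  cases n <;> simp [jacobiSeq] <;> ring

/-- The Jacobi operator in `ℓ²(ℤ₊)`: its domain consists of all `f ∈ ℓ²(ℤ₊)` such that
`J f ∈ ℓ²(ℤ₊)`. (When the operator on finitely supported sequences is essentially self-adjoint,
this is its closure.) -/
def jacobiOp (a b : ℕ → ℝ) : EllTwo →ₗ.[ℂ] EllTwo where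
  domain :=
    { carrier := {f | Memℓp (jacobiSeq a b (f : ℕ → ℂ)) 2}
      zero_mem' := by
        have h : jacobiSeq a b ((0 : EllTwo) : ℕ → ℂ) = 0 := by
          funext n
          cases n <;> simp [jacobiSeq]
        change Memℓp (jacobiSeq a b ((0 : EllTwo) : ℕ → ℂ)) 2
        rw [h]
        exact zero_memℓp
      add_mem' := by
        intro f g hf hg
        change Memℓp (jacobiSeq a b ((f + g : EllTwo) : ℕ → ℂ)) 2
        rw [lp.coeFn_add, jacobiSeq_add]
        exact hf.add hg
      smul_mem' := by
        intro c f hf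
        change Memℓp (jacobiSeq a b ((c • f : EllTwo) : ℕ → ℂ)) 2
        rw [lp.coeFn_smul, jacobiSeq_smul]
        exact hf.const_smul c }
  toFun :=
    { toFun := fun f => ⟨jacobiSeq a b ((f : EllTwo) : ℕ → ℂ), f.2⟩
      map_add' := by
        intro f g
        apply lp.ext
        change jacobiSeq a b (((f : EllTwo) + (g : EllTwo) : EllTwo) : ℕ → ℂ) = _
        rw [lp.coeFn_add, jacobiSeq_add]
        rfl
      map_smul' := by
        intro c f
        apply lp.ext
        change jacobiSeq a b ((c • (f : EllTwo) : EllTwo) : ℕ → ℂ) = _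
        rw [lp.coeFn_smul, jacobiSeq_smul]
        rfl }

/-- `W` is the unitary group `W t = e^{-iAt}`: a strongly continuous one-parameter group of unitary
operators such that `A` is exactly the operator `f ↦ lim_{t → 0} i (W t f - f) / t`, defined on the
set of all `f` for which this limit exists. -/
structure IsUnitaryGroupOf {E : Type*} [NormedAddCommGroup E] [InnerProductSpace ℂ E]
    (A : E →ₗ.[ℂ] E) (W : ℝ → (E ≃ₗᵢ[ℂ] E)) : Prop where
  map_zero : ∀ f : E, W 0 f = f
  map_add : ∀ (s t : ℝ) (f : E), W (s + t) f = W s (W t f)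
  strong_continuous : ∀ f : E, Continuous fun t : ℝ => W t f
  generator : ∀ f h : E, (f, h) ∈ A.graph ↔
    Tendsto (fun t : ℝ => (Complex.I / (t : ℂ)) • (W t f - f)) (𝓝[≠] 0) (𝓝 h)

/-- The orthonormal polynomials of the recurrence coefficients `a`, `b`:
`a_{n-1} P_{n-1} + b_n P_n + a_n P_{n+1} = x P_n`, with `P_{-1} = 0`, `P_0 = 1`. -/
def orthoPoly (a b : ℕ → ℝ) : ℕ → Polynomial ℝ
  | 0 => 1
  | 1 => Polynomial.C (a 0)⁻¹ * (Polynomial.X - Polynomial.C (b 0))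
  | n + 2 => Polynomial.C (a (n + 1))⁻¹ *
      ((Polynomial.X - Polynomial.C (b (n + 1))) * orthoPoly a b (n + 1)
        - Polynomial.C (a n) * orthoPoly a b n)

/-- The Hermite coefficients `a_n = √((n + 1) / 2)`. -/
def hermiteA (n : ℕ) : ℝ := Real.sqrt (((n : ℝ) + 1) / 2)

/-- The Hermite coefficients `b_n = 0`. -/
def hermiteB (_ : ℕ) : ℝ := 0

/-- The Hermite operator. -/
def hermiteJ : EllTwo →ₗ.[ℂ] EllTwo := jacobiOp hermiteA hermiteB

/-- The orthonormal Hermite polynomials `H_n`, with `H_0 = 1`. -/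
def hermiteH (n : ℕ) : Polynomial ℝ := orthoPoly hermiteA hermiteB n

/-- The functions `π^{-1/4} e^{-x²/2} H_n(x)`. -/
def hermiteFun (n : ℕ) (x : ℝ) : ℝ :=
  Real.pi ^ (-(1 / 4) : ℝ) * Real.exp (-x ^ 2 / 2) * (hermiteH n).eval x

/-! The functions `hermiteFun n` are orthonormal. -/

theorem hermiteA_pos (n : ℕ) : 0 < hermiteA n := Real.sqrt_pos.2 (by positivity)

theorem hermiteA_sq (n : ℕ) : hermiteA n ^ 2 = ((n : ℝ) + 1) / 2 :=
  Real.sq_sqrt (by positivity)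

theorem hermiteH_one : Polynomial.C (hermiteA 0) * hermiteH 1 = Polynomial.X := by
  have h : Polynomial.C (hermiteA 0) * Polynomial.C (hermiteA 0)⁻¹ = 1 := by
    rw [← Polynomial.C_mul, mul_inv_cancel₀ (hermiteA_pos 0).ne', Polynomial.C_1]
  simp only [hermiteH, orthoPoly, hermiteB, Polynomial.C_0, sub_zero]
  rw [← mul_assoc, h, one_mul]

theorem hermiteH_succ (n : ℕ) : Polynomial.C (hermiteA (n + 1)) * hermiteH (n + 2) =
    Polynomial.X * hermiteH (n + 1) - Polynomial.C (hermiteA n) * hermiteH n := by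
  have h : Polynomial.C (hermiteA (n + 1)) * Polynomial.C (hermiteA (n + 1))⁻¹ = 1 := by
    rw [← Polynomial.C_mul, mul_inv_cancel₀ (hermiteA_pos (n + 1)).ne', Polynomial.C_1]
  simp only [hermiteH]
  rw [orthoPoly, ← mul_assoc, h, one_mul]
  simp [hermiteB]

theorem hermiteH_deriv (n : ℕ) : Polynomial.derivative (hermiteH (n + 1)) =
    Polynomial.C (2 * hermiteA n) * hermiteH n := by
  have key : ∀ n, Polynomial.derivative (hermiteH (n + 1)) =
      Polynomial.C (2 * hermiteA n) * hermiteH n ∧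
      Polynomial.derivative (hermiteH (n + 2)) =
      Polynomial.C (2 * hermiteA (n + 1)) * hermiteH (n + 1) := by
    intro n
    induction n with
    | zero =>
      have h1 : Polynomial.derivative (hermiteH 1) =
          Polynomial.C (2 * hermiteA 0) * hermiteH 0 := by
        have hC : Polynomial.C (hermiteA 0) ≠ 0 := by
          simpa using (hermiteA_pos 0).ne'
        apply mul_left_cancel₀ hC
        have h := congrArg Polynomial.derivative hermiteH_one
        rw [Polynomial.derivative_C_mul, Polynomial.derivative_X] at h
        rw [h, ← mul_assoc, ← Polynomial.C_mul]
        have : hermiteA 0 * (2 * hermiteA 0) = 1 := by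
          have := hermiteA_sq 0
          push_cast at this
          nlinarith
        rw [this]
        simp [hermiteH, orthoPoly]
      refine ⟨h1, ?_⟩
      have hC : Polynomial.C (hermiteA 1) ≠ 0 := by
        simpa using (hermiteA_pos 1).ne'
      apply mul_left_cancel₀ hC
      have h := congrArg Polynomial.derivative (hermiteH_succ 0)
      have h0 : Polynomial.derivative (hermiteH 0) = 0 := by simp [hermiteH, orthoPoly]
      simp only [zero_add, Polynomial.derivative_C, Polynomial.derivative_sub, zero_mul,
        Polynomial.derivative_mul, Polynomial.derivative_X, one_mul, h0, mul_zero, sub_zero] at h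
      simp only [zero_add]
      rw [h, h1]
      have hX : Polynomial.X * (Polynomial.C (2 * hermiteA 0) * hermiteH 0) =
          2 * (Polynomial.C (hermiteA 0) ^ 2 * hermiteH 1) := by
        rw [← hermiteH_one]
        simp only [hermiteH, orthoPoly, map_mul]
        simp only [map_ofNat]
        ring
      rw [hX]
      have e : Polynomial.C (hermiteA 1) * Polynomial.C (hermiteA 1) =
          Polynomial.C (hermiteA 0) * Polynomial.C (hermiteA 0) + Polynomial.C (1 / 2 : ℝ) := by
        rw [← Polynomial.C_mul, ← Polynomial.C_mul, ← Polynomial.C_add]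
        congr 1
        have h1 := hermiteA_sq 0
        have h2 := hermiteA_sq 1
        push_cast at h1 h2
        nlinarith
      have e2 : (2 : Polynomial ℝ) * Polynomial.C (1 / 2 : ℝ) = 1 := by
        have e2 : (2 : Polynomial ℝ) = Polynomial.C 2 := (map_ofNat Polynomial.C 2).symm
        rw [e2, ← Polynomial.C_mul]
        norm_num
      simp only [map_mul, map_ofNat]
      linear_combination (-2 * hermiteH 1) * e - hermiteH 1 * e2
    | succ k ih =>
      refine ⟨ih.2, ?_⟩
      have hC : Polynomial.C (hermiteA (k + 2)) ≠ 0 := by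
        simpa using (hermiteA_pos (k + 2)).ne'
      apply mul_left_cancel₀ hC
      have h := congrArg Polynomial.derivative (hermiteH_succ (k + 1))
      simp only [Polynomial.derivative_C, Polynomial.derivative_sub, zero_mul, zero_add,
        Polynomial.derivative_mul, Polynomial.derivative_X, one_mul] at h
      have hk := hermiteH_succ k
      change Polynomial.C (hermiteA (k + 2)) * Polynomial.derivative (hermiteH (k + 3)) =
        Polynomial.C (hermiteA (k + 2)) * (Polynomial.C (2 * hermiteA (k + 2)) * hermiteH (k + 2))
      change Polynomial.C (hermiteA (k + 2)) * Polynomial.derivative (hermiteH (k + 3)) =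
        hermiteH (k + 2) + Polynomial.X * Polynomial.derivative (hermiteH (k + 2))
          - Polynomial.C (hermiteA (k + 1)) * Polynomial.derivative (hermiteH (k + 1)) at h
      rw [h, ih.1, ih.2]
      have e : Polynomial.C (hermiteA (k + 2)) * Polynomial.C (hermiteA (k + 2)) =
          Polynomial.C (hermiteA (k + 1)) * Polynomial.C (hermiteA (k + 1))
            + Polynomial.C (1 / 2 : ℝ) := by
        rw [← Polynomial.C_mul, ← Polynomial.C_mul, ← Polynomial.C_add]
        congr 1
        have h1 := hermiteA_sq (k + 1)
        have h2 := hermiteA_sq (k + 2)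
        push_cast at h1 h2
        nlinarith
      have e2 : (2 : Polynomial ℝ) * Polynomial.C (1 / 2 : ℝ) = 1 := by
        have e2 : (2 : Polynomial ℝ) = Polynomial.C 2 := (map_ofNat Polynomial.C 2).symm
        rw [e2, ← Polynomial.C_mul]
        norm_num
      simp only [map_mul, map_ofNat]
      linear_combination (-2 * Polynomial.C (hermiteA (k + 1))) * hk
        - 2 * hermiteH (k + 2) * e - hermiteH (k + 2) * e2
  exact (key n).1

theorem integrable_eval_mul_gauss (p : Polynomial ℝ) :
    Integrable (fun x : ℝ => p.eval x * Real.exp (-x ^ 2)) := by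
  induction p using Polynomial.induction_on' with
  | add p q hp hq =>
    refine (hp.add hq).congr (ae_of_all _ fun x => ?_)
    simp [add_mul]
  | monomial n c =>
    have h := (integrable_rpow_mul_exp_neg_mul_sq (b := 1) one_pos (s := (n : ℝ))
      (by have : (0 : ℝ) ≤ n := n.cast_nonneg
          linarith)).const_mul c
    refine h.congr (ae_of_all _ fun x => ?_)
    simp [Polynomial.eval_monomial, mul_assoc]

/-- The integral of a polynomial with the weight `e^{-x²}`. -/
def gaussInt (p : Polynomial ℝ) : ℝ := ∫ x : ℝ, p.eval x * Real.exp (-x ^ 2)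

theorem gaussInt_add (p q : Polynomial ℝ) : gaussInt (p + q) = gaussInt p + gaussInt q := by
  unfold gaussInt
  rw [← integral_add (integrable_eval_mul_gauss p) (integrable_eval_mul_gauss q)]
  simp [add_mul]

theorem gaussInt_C_mul (c : ℝ) (p : Polynomial ℝ) :
    gaussInt (Polynomial.C c * p) = c * gaussInt p := by
  unfold gaussInt
  rw [← integral_const_mul]
  simp [mul_assoc]

theorem gaussInt_X_mul (p : Polynomial ℝ) :
    2 * gaussInt (Polynomial.X * p) = gaussInt (Polynomial.derivative p) := by
  have hd : ∀ x : ℝ, HasDerivAt (fun x : ℝ => p.eval x * Real.exp (-x ^ 2))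
      ((Polynomial.derivative p + Polynomial.C (-2) * (Polynomial.X * p)).eval x
        * Real.exp (-x ^ 2)) x := by
    intro x
    have h1 := p.hasDerivAt x
    have h2 : HasDerivAt (fun x : ℝ => Real.exp (-x ^ 2))
        (Real.exp (-x ^ 2) * (-(2 * x))) x := by
      have := ((hasDerivAt_pow 2 x).neg).exp
      simpa using this
    refine (h1.mul h2).congr_deriv ?_
    rw [Polynomial.eval_add, Polynomial.eval_mul, Polynomial.eval_C, Polynomial.eval_mul,
      Polynomial.eval_X]
    ring
  have h := integral_eq_zero_of_hasDerivAt_of_integrable hd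
    (integrable_eval_mul_gauss _) (integrable_eval_mul_gauss p)
  have h' : gaussInt (Polynomial.derivative p + Polynomial.C (-2) * (Polynomial.X * p)) = 0 := h
  rw [gaussInt_add, gaussInt_C_mul] at h'
  linarith

theorem gaussInt_mul_succ (q : Polynomial ℝ) (n : ℕ) :
    hermiteA n * gaussInt (q * hermiteH (n + 1)) =
      gaussInt (Polynomial.derivative q * hermiteH n) / 2 := by
  rw [← gaussInt_C_mul]
  cases n with
  | zero =>
    have e : Polynomial.C (hermiteA 0) * (q * hermiteH 1) = Polynomial.X * q := by
      rw [← hermiteH_one]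
      ring
    have h := gaussInt_X_mul q
    change gaussInt (Polynomial.C (hermiteA 0) * (q * hermiteH 1)) = _
    rw [e]
    have : hermiteH 0 = 1 := rfl
    rw [this, mul_one]
    linarith
  | succ k =>
    have e : Polynomial.C (hermiteA (k + 1)) * (q * hermiteH (k + 2)) =
        Polynomial.X * (q * hermiteH (k + 1))
          + Polynomial.C (-hermiteA k) * (q * hermiteH k) := by
      have := hermiteH_succ k
      rw [Polynomial.C_neg]
      linear_combination q * this
    have h := gaussInt_X_mul (q * hermiteH (k + 1))
    have e' : Polynomial.derivative (q * hermiteH (k + 1)) =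
        Polynomial.derivative q * hermiteH (k + 1)
          + Polynomial.C (2 * hermiteA k) * (q * hermiteH k) := by
      rw [Polynomial.derivative_mul, hermiteH_deriv]
      ring
    rw [e', gaussInt_add, gaussInt_C_mul] at h
    change gaussInt (Polynomial.C (hermiteA (k + 1)) * (q * hermiteH (k + 2))) = _
    rw [e, gaussInt_add, gaussInt_C_mul]
    linarith

theorem gaussInt_hermiteH (m n : ℕ) :
    gaussInt (hermiteH m * hermiteH n) = if m = n then Real.sqrt Real.pi else 0 := by
  have h0 : hermiteH 0 = 1 := rfl
  have hz : gaussInt 0 = 0 := by simp [gaussInt]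
  have base : ∀ n, gaussInt (hermiteH 0 * hermiteH (n + 1)) = 0 := by
    intro n
    have h := gaussInt_mul_succ (hermiteH 0) n
    rw [h0, Polynomial.derivative_one, zero_mul, hz, zero_div] at h
    rw [h0]
    exact (mul_eq_zero.1 h).resolve_left (hermiteA_pos n).ne'
  induction m generalizing n with
  | zero =>
    cases n with
    | zero =>
      have := integral_gaussian 1
      simpa [gaussInt, h0] using this
    | succ n => simpa using base n
  | succ m ih =>
    cases n with
    | zero =>
      rw [mul_comm]
      simpa using base m
    | succ n =>
      have h := gaussInt_mul_succ (hermiteH (m + 1)) n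
      rw [hermiteH_deriv, mul_assoc, gaussInt_C_mul, ih n] at h
      by_cases hmn : m = n
      · subst hmn
        simp only [if_true] at h ⊢
        have := hermiteA_pos m
        apply mul_left_cancel₀ this.ne'
        linarith
      · simp only [hmn, if_false, mul_zero, zero_div] at h
        simp only [Nat.add_right_cancel_iff, hmn, if_false]
        exact (mul_eq_zero.1 h).resolve_left (hermiteA_pos n).ne'

theorem hermiteFun_mul (m n : ℕ) (x : ℝ) : hermiteFun m x * hermiteFun n x =
    (Real.sqrt Real.pi)⁻¹ * ((hermiteH m * hermiteH n).eval x * Real.exp (-x ^ 2)) := by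
  have h1 : Real.exp (-x ^ 2 / 2) * Real.exp (-x ^ 2 / 2) = Real.exp (-x ^ 2) := by
    rw [← Real.exp_add]
    congr 1
    ring
  have h2 : Real.pi ^ (-(1 / 4) : ℝ) * Real.pi ^ (-(1 / 4) : ℝ) = (Real.sqrt Real.pi)⁻¹ := by
    rw [← Real.rpow_add Real.pi_pos, Real.sqrt_eq_rpow, ← Real.rpow_neg Real.pi_pos.le]
    norm_num
  rw [← h1, ← h2, Polynomial.eval_mul]
  unfold hermiteFun
  ring

theorem integral_hermiteFun_mul (m n : ℕ) :
    ∫ x : ℝ, hermiteFun m x * hermiteFun n x = if m = n then 1 else 0 := by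
  simp_rw [hermiteFun_mul]
  rw [integral_const_mul]
  have := gaussInt_hermiteH m n
  unfold gaussInt at this
  rw [this]
  have hp : Real.sqrt Real.pi ≠ 0 := (Real.sqrt_pos.2 Real.pi_pos).ne'
  split_ifs
  · exact inv_mul_cancel₀ hp
  · simp

theorem continuous_hermiteFun (n : ℕ) : Continuous (hermiteFun n) := by
  unfold hermiteFun
  have := (hermiteH n).continuous
  fun_prop

theorem memLp_hermiteFun (n : ℕ) :
    MemLp (fun x : ℝ => (hermiteFun n x : ℂ)) 2 (volume : Measure ℝ) := by
  have hc : Continuous (fun x : ℝ => (hermiteFun n x : ℂ)) :=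
    Complex.continuous_ofReal.comp (continuous_hermiteFun n)
  rw [memLp_two_iff_integrable_sq_norm hc.aestronglyMeasurable]
  refine ((integrable_eval_mul_gauss (hermiteH n * hermiteH n)).const_mul
    (Real.sqrt Real.pi)⁻¹).congr (ae_of_all _ fun x => ?_)
  change (Real.sqrt Real.pi)⁻¹ * ((hermiteH n * hermiteH n).eval x * Real.exp (-x ^ 2)) =
    ‖(hermiteFun n x : ℂ)‖ ^ 2
  rw [← hermiteFun_mul, Complex.norm_real, Real.norm_eq_abs, sq_abs, sq]

/-- `hermiteFun n` as an element of `L²(ℝ)`. -/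
def hermiteVec (n : ℕ) : LTwo := (memLp_hermiteFun n).toLp _

theorem orthonormal_hermiteVec : Orthonormal ℂ hermiteVec := by
  rw [orthonormal_iff_ite]
  intro m n
  rw [L2.inner_def]
  have h : ∀ᵐ x : ℝ, inner ℂ (hermiteVec m x) (hermiteVec n x) =
      ((hermiteFun m x * hermiteFun n x : ℝ) : ℂ) := by
    filter_upwards [(memLp_hermiteFun m).coeFn_toLp, (memLp_hermiteFun n).coeFn_toLp] with x h1 h2
    unfold hermiteVec
    rw [h1, h2]
    simp [mul_comm]
  rw [integral_congr_ae h, integral_complex_ofReal, integral_hermiteFun_mul]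
  split_ifs <;> simp

/-- The isometry `Φ : ℓ²(ℤ₊) → L²(ℝ)`, `Φ f = π^{-1/4} ∑ₙ e^{-x²/2} H_n(x) f_n`, where the series
converges in `L²(ℝ)`. -/
def hermitePhi : EllTwo →ₗᵢ[ℂ] LTwo :=
  OrthogonalFamily.linearIsometry (𝕜 := ℂ) orthonormal_hermiteVec.orthogonalFamily

theorem hermitePhi_hasSum (f : EllTwo) : HasSum (fun n => f n • hermiteVec n) (hermitePhi f) :=
  OrthogonalFamily.hasSum_linearIsometry orthonormal_hermiteVec.orthogonalFamily f

/-- The unitary Fourier transform `ĝ(x) = (2π)^{-1/2} ∫ e^{-ixy} g(y) dy`. -/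
def fourierHat (g : ℝ → ℂ) (x : ℝ) : ℂ :=
  ((Real.sqrt (2 * Real.pi))⁻¹ : ℂ) * ∫ y : ℝ, Complex.exp (-(Complex.I * x * y)) * g y

/-- `(U(t) g)_n = i^{∓n} (2n+1)^{-1/4} ĝ(t ∓ √(2n+1))` for `±t > 0`
(only values at `t ≠ 0` are meaningful). -/
def hermiteU (t : ℝ) (g : ℝ → ℂ) (n : ℕ) : ℂ :=
  if 0 < t then
    Complex.I ^ (-(n : ℤ)) * (((2 * (n : ℝ) + 1) ^ (-(1 / 4) : ℝ) : ℝ) : ℂ)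
      * fourierHat g (t - Real.sqrt (2 * (n : ℝ) + 1))
  else
    Complex.I ^ (n : ℤ) * (((2 * (n : ℝ) + 1) ^ (-(1 / 4) : ℝ) : ℝ) : ℂ)
      * fourierHat g (t + Real.sqrt (2 * (n : ℝ) + 1))

end

noncomputable section

/-! ### The Hermite functions on compact sets -/

/-! The Hermite functions φ_n = `hermiteFun n` are complete in L²(ℝ), so Φ is unitary, and the
three-term recurrence turns J into multiplication by x. Hence e^{-iJt} = Φ⁻¹ e^{-itx} Φ, and if Φf =
g, then the n-th coefficient of e^{-iJt}f is ∫ φ_n(x) e^{-itx} g(x) dx (`hermiteGroup_coeff`).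

Since g has compact support, only φ_n on a compact set matters. Write ν = √(2n+1) and m =
(2n+1)^{-1/4}, so that m²ν = 1. There φ_n is a combination of e^{iνx} and e^{-iνx} with amplitude of
order m, up to an error O(m³) (`exists_norm_hermiteFun_sub_wave_le`). The two exponentials
contribute ĝ(t-ν) and ĝ(t+ν). One of these is the coefficient of U(t)g; in the other the argument is
at least ν in modulus, so the decay of ĝ makes it O(m/ν) = O(m³).

Thus the n-th coefficient of e^{-iJt}f - U(t)g is O(m³) uniformly in t
(`exists_norm_coeff_sub_hermiteU_le`). The squares O((2n+1)^{-3/2}) are summable, each coefficient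
tends to 0 as t → ±∞ by decay of Fourier transforms, and dominated convergence for series gives the
limit.

Uniqueness of the group holds because two groups with the same generator agree on its domain, which
contains the standard basis. -/

theorem hermiteFun_one (x : ℝ) : hermiteA 0 * hermiteFun 1 x = x * hermiteFun 0 x := by
  have h := congrArg (Polynomial.eval x) hermiteH_one
  have h0 : hermiteH 0 = 1 := rfl
  simp only [Polynomial.eval_mul, Polynomial.eval_C, Polynomial.eval_X] at h
  simp only [hermiteFun, h0, Polynomial.eval_one]
  linear_combination (Real.pi ^ (-(1 / 4) : ℝ) * Real.exp (-x ^ 2 / 2)) * h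

theorem hermiteFun_succ (n : ℕ) (x : ℝ) : hermiteA (n + 1) * hermiteFun (n + 2) x =
    x * hermiteFun (n + 1) x - hermiteA n * hermiteFun n x := by
  have h := congrArg (Polynomial.eval x) (hermiteH_succ n)
  simp only [Polynomial.eval_mul, Polynomial.eval_C, Polynomial.eval_X, Polynomial.eval_sub] at h
  simp only [hermiteFun]
  linear_combination (Real.pi ^ (-(1 / 4) : ℝ) * Real.exp (-x ^ 2 / 2)) * h

/-- The derivative of `hermiteFun n`. -/
def hermiteFunDeriv (n : ℕ) (x : ℝ) : ℝ := x * hermiteFun n x - 2 * hermiteA n * hermiteFun (n + 1) x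

theorem hasDerivAt_hermiteFun_aux (n : ℕ) (x : ℝ) : HasDerivAt (hermiteFun n)
    (Real.pi ^ (-(1 / 4) : ℝ) * Real.exp (-x ^ 2 / 2) *
      ((Polynomial.derivative (hermiteH n)).eval x - x * (hermiteH n).eval x)) x := by
  have h1 := (hermiteH n).hasDerivAt x
  have h2 : HasDerivAt (fun x : ℝ => Real.exp (-x ^ 2 / 2)) (Real.exp (-x ^ 2 / 2) * (-x)) x := by
    have := (((hasDerivAt_pow 2 x).neg).div_const 2).exp
    refine this.congr_deriv ?_
    simp
    ring
  refine ((h2.const_mul (Real.pi ^ (-(1 / 4) : ℝ))).mul h1).congr_deriv ?_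
  ring

theorem hasDerivAt_hermiteFun_succ (n : ℕ) (x : ℝ) : HasDerivAt (hermiteFun (n + 1))
    (2 * hermiteA n * hermiteFun n x - x * hermiteFun (n + 1) x) x := by
  refine (hasDerivAt_hermiteFun_aux (n + 1) x).congr_deriv ?_
  rw [hermiteH_deriv, Polynomial.eval_mul, Polynomial.eval_C]
  simp only [hermiteFun]
  ring

theorem hasDerivAt_hermiteFun (n : ℕ) (x : ℝ) :
    HasDerivAt (hermiteFun n) (hermiteFunDeriv n x) x := by
  cases n with
  | zero =>
    refine (hasDerivAt_hermiteFun_aux 0 x).congr_deriv ?_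
    have h0 : hermiteH 0 = 1 := rfl
    have h1 := hermiteFun_one x
    simp only [hermiteFunDeriv, h0, Polynomial.derivative_one, Polynomial.eval_zero,
      Polynomial.eval_one]
    have h2 : hermiteFun 0 x = Real.pi ^ (-(1 / 4) : ℝ) * Real.exp (-x ^ 2 / 2) := by
      simp [hermiteFun, h0]
    simp only [zero_add]
    linear_combination 2 * h1 + x * h2
  | succ n =>
    refine (hasDerivAt_hermiteFun_succ n x).congr_deriv ?_
    have := hermiteFun_succ n x
    simp only [hermiteFunDeriv]
    linear_combination 2 * this

/-- The Hermite equation φ'' = (x² - (2n+1))φ follows by composing the raising and lowering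
relations, since 4a_n² = 2n+2. -/
theorem hasDerivAt_hermiteFunDeriv (n : ℕ) (x : ℝ) : HasDerivAt (hermiteFunDeriv n)
    ((x ^ 2 - (2 * (n : ℝ) + 1)) * hermiteFun n x) x := by
  have h1 := (hasDerivAt_id x).mul (hasDerivAt_hermiteFun n x)
  have h2 := (hasDerivAt_hermiteFun_succ n x).const_mul (2 * hermiteA n)
  refine (h1.sub h2).congr_deriv ?_
  have := hermiteA_sq n
  simp only [hermiteFunDeriv, id]
  linear_combination (-4 * hermiteFun n x) * this

theorem contDiff_hermiteFun (n : ℕ) : ContDiff ℝ (⊤ : ℕ∞) (hermiteFun n) := by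
  unfold hermiteFun
  have : ContDiff ℝ (⊤ : ℕ∞) fun x => (hermiteH n).eval x := by
    simpa [Polynomial.aeval_def] using (hermiteH n).contDiff_aeval (𝕜 := ℝ) (R := ℝ) (n := (⊤ : ℕ∞))
  fun_prop

/-! ### Values at the origin and the Wallis product. -/

theorem hermiteFun_zero_odd (k : ℕ) : hermiteFun (2 * k + 1) 0 = 0 := by
  induction k with
  | zero =>
    have := hermiteFun_one 0
    rw [zero_mul] at this
    exact (mul_eq_zero.1 this).resolve_left (hermiteA_pos 0).ne'
  | succ k ih =>
    have := hermiteFun_succ (2 * k + 1) 0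
    rw [ih, zero_mul, mul_zero, sub_zero] at this
    exact (mul_eq_zero.1 this).resolve_left (hermiteA_pos _).ne'

theorem hermiteFun_zero_even_nonneg (k : ℕ) : 0 ≤ (-1) ^ k * hermiteFun (2 * k) 0 := by
  induction k with
  | zero =>
    have h0 : hermiteH 0 = 1 := rfl
    simp only [hermiteFun, h0, Polynomial.eval_one, mul_zero, pow_zero]
    positivity
  | succ k ih =>
    have := hermiteFun_succ (2 * k) 0
    rw [zero_mul] at this
    have ha := hermiteA_pos (2 * k)
    have hb := hermiteA_pos (2 * k + 1)
    rw [show 2 * (k + 1) = 2 * k + 2 by ring]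
    refine le_of_mul_le_mul_left ?_ hb
    have e : hermiteA (2 * k + 1) * ((-1) ^ (k + 1) * hermiteFun (2 * k + 2) 0) =
        hermiteA (2 * k) * ((-1) ^ k * hermiteFun (2 * k) 0) := by
      linear_combination ((-1) ^ (k + 1)) * this
    rw [e, mul_zero]
    positivity

/-- At x = 0 the recurrence links only φ_{2k} and φ_{2k+2}. The fourth power clears both the square
roots in a_n and the factor π^{-1/4}, and leaves rational ratios that telescope to the Wallis
product. -/
theorem hermiteFun_zero_even_pow (k : ℕ) : hermiteFun (2 * k) 0 ^ 4 *
    ((2 * (k : ℝ) + 1) * Real.Wallis.W k * Real.pi) = 1 := by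
  induction k with
  | zero =>
    have h0 : hermiteH 0 = 1 := rfl
    simp only [hermiteFun, h0, Polynomial.eval_one, mul_zero, Real.Wallis.W]
    have : (Real.pi ^ (-(1 / 4) : ℝ)) ^ 4 = Real.pi⁻¹ := by
      rw [← Real.rpow_natCast, ← Real.rpow_mul Real.pi_pos.le, ← Real.rpow_neg_one]
      norm_num
    simp
    norm_num at this ⊢
    rw [this, inv_mul_cancel₀ Real.pi_ne_zero]
  | succ k ih =>
    have h := hermiteFun_succ (2 * k) 0
    have ha := hermiteA_sq (2 * k)
    have hb := hermiteA_sq (2 * k + 1)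
    push_cast at ha hb
    rw [show 2 * (k + 1) = 2 * k + 2 by ring, Real.Wallis.W_succ]
    have hk : (0 : ℝ) ≤ k := k.cast_nonneg
    have h4 : (hermiteA (2 * k + 1) ^ 2) ^ 2 * hermiteFun (2 * k + 2) 0 ^ 4 =
        (hermiteA (2 * k) ^ 2) ^ 2 * hermiteFun (2 * k) 0 ^ 4 := by
      have : (hermiteA (2 * k + 1) * hermiteFun (2 * k + 2) 0) ^ 4 =
        (0 * hermiteFun (2 * k + 1) 0 - hermiteA (2 * k) * hermiteFun (2 * k) 0) ^ 4 := by rw [h]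
      linear_combination this
    rw [ha, hb] at h4
    have e : hermiteFun (2 * k + 2) 0 ^ 4 = ((2 * k + 1) / (2 * k + 2)) ^ 2 *
        hermiteFun (2 * k) 0 ^ 4 := by
      field_simp at h4 ⊢
      linear_combination h4
    rw [e]
    refine Eq.trans ?_ ih
    push_cast
    field_simp
    ring

/-- Lets an error estimate for a fourth power, where the Wallis product is explicit, pass to the
quantity itself. -/
theorem abs_sub_one_le_abs_pow_four {r : ℝ} (hr : 0 ≤ r) : |r - 1| ≤ |r ^ 4 - 1| := by
  have : r ^ 4 - 1 = (r - 1) * ((r + 1) * (r ^ 2 + 1)) := by ring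
  rw [this, abs_mul]
  have h : 1 ≤ |(r + 1) * (r ^ 2 + 1)| := by
    rw [abs_of_nonneg (by positivity)]
    nlinarith [mul_nonneg hr (sq_nonneg r), sq_nonneg r]
  nlinarith [abs_nonneg (r - 1)]

/-- The constant `(2 / π)^{1/2}`, the amplitude of the oscillations of the Hermite functions. -/
def hermiteAmp : ℝ := Real.sqrt (2 / Real.pi)

theorem hermiteAmp_pos : 0 < hermiteAmp := Real.sqrt_pos.2 (by positivity)

theorem hermiteAmp_sq : hermiteAmp ^ 2 = 2 / Real.pi := Real.sq_sqrt (by positivity)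

theorem hermiteAmp_le_one : hermiteAmp ≤ 1 := by
  unfold hermiteAmp
  rw [Real.sqrt_le_one, div_le_one Real.pi_pos]
  linarith [Real.pi_gt_three]

/-- `(2n+1)^{-1/4}`. -/
def hermiteScale (n : ℕ) : ℝ := (2 * (n : ℝ) + 1) ^ (-(1 / 4) : ℝ)

theorem hermiteScale_pos (n : ℕ) : 0 < hermiteScale n := by
  unfold hermiteScale
  positivity

theorem sqrt_mul_hermiteScale_sq (n : ℕ) :
    Real.sqrt (2 * (n : ℝ) + 1) * hermiteScale n ^ 2 = 1 := by
  have h : (0 : ℝ) < 2 * (n : ℝ) + 1 := by positivity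
  unfold hermiteScale
  rw [← Real.rpow_natCast, ← Real.rpow_mul h.le, Real.sqrt_eq_rpow, ← Real.rpow_add h]
  norm_num

theorem hermiteScale_pow_four (n : ℕ) : (2 * (n : ℝ) + 1) * hermiteScale n ^ 4 = 1 := by
  have h : (0 : ℝ) ≤ 2 * (n : ℝ) + 1 := by positivity
  have h1 := sqrt_mul_hermiteScale_sq n
  have h2 := Real.sq_sqrt h
  calc _ = (Real.sqrt (2 * (n : ℝ) + 1) * hermiteScale n ^ 2) ^ 2 := by rw [mul_pow, h2]; ring
    _ = 1 := by rw [h1]; ring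

theorem hermiteScale_le_one (n : ℕ) : hermiteScale n ≤ 1 := by
  have h := hermiteScale_pow_four n
  have h0 := hermiteScale_pos n
  have hn : (0 : ℝ) ≤ n := n.cast_nonneg
  by_contra! hc
  have : 1 < hermiteScale n ^ 4 := one_lt_pow₀ hc (by norm_num)
  nlinarith

/-- The ratio of the two compared quantities has fourth power (4k+1)π / (4(2k+1)W_k). The bounds
(2k+1)/(2k+2) · π/2 ≤ W_k ≤ π/2 put it within 1/(4k+1) = m⁴ of 1; multiplying by the amplitude, at
most 1/m, leaves m³. -/
theorem hermiteFun_zero_even_approx (k : ℕ) :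
    |Real.sqrt (2 * ((2 * k : ℕ) : ℝ) + 1) * ((-1) ^ k * hermiteFun (2 * k) 0)
      - hermiteAmp / hermiteScale (2 * k)| ≤ hermiteScale (2 * k) ^ 3 := by
  have h4 := hermiteFun_zero_even_pow k
  have hs := hermiteFun_zero_even_nonneg k
  set s := (-1) ^ k * hermiteFun (2 * k) 0 with hsdef
  have hs4 : s ^ 4 = hermiteFun (2 * k) 0 ^ 4 := by
    rw [hsdef, mul_pow, ← pow_mul, Even.neg_one_pow (by exact ⟨2 * k, by ring⟩), one_mul]
  rw [← hs4] at h4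
  have hm := hermiteScale_pos (2 * k)
  have hν := sqrt_mul_hermiteScale_sq (2 * k)
  have hN := hermiteScale_pow_four (2 * k)
  have hsq := Real.sq_sqrt (show (0 : ℝ) ≤ 2 * ((2 * k : ℕ) : ℝ) + 1 by positivity)
  set ν := Real.sqrt (2 * ((2 * k : ℕ) : ℝ) + 1)
  have hν0 : 0 ≤ ν := Real.sqrt_nonneg _
  set m := hermiteScale (2 * k)
  have hA := hermiteAmp_pos
  have hA2 := hermiteAmp_sq
  have hA1 := hermiteAmp_le_one
  have hW := Real.Wallis.W_pos k
  have hW1 := Real.Wallis.W_le k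
  have hW2 := Real.Wallis.le_W k
  set W := Real.Wallis.W k
  have hπ := Real.pi_pos
  have hk : (0 : ℝ) ≤ k := k.cast_nonneg
  push_cast at hN hsq
  have hr : |ν * s * m / hermiteAmp - 1| ≤ m ^ 4 := by
    refine (abs_sub_one_le_abs_pow_four (by positivity)).trans ?_
    have e : (ν * s * m / hermiteAmp) ^ 4 =
        (4 * k + 1) * Real.pi / (4 * (2 * k + 1) * W) := by
      have hA4 : hermiteAmp ^ 4 = (2 / Real.pi) ^ 2 := by rw [← hA2]; ring
      have hs4' : s ^ 4 = 1 / ((2 * (k : ℝ) + 1) * W * Real.pi) := by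
        rw [eq_div_iff (by positivity)]; exact h4
      have hνm : (ν * m) ^ 4 = 4 * k + 1 := by
        calc (ν * m) ^ 4 = (ν ^ 2) * ((ν ^ 2) * m ^ 4) := by ring
          _ = _ := by rw [hsq, hN]; ring
      rw [div_pow, mul_right_comm, mul_pow, hνm, hA4, hs4']
      field_simp
      ring
    have hm4 : m ^ 4 = 1 / (4 * k + 1) := by
      rw [eq_div_iff (by positivity)]; linarith
    rw [e, hm4, abs_le]
    constructor
    · have : (4 * k + 1) / (4 * (2 * k + 1) * (1 / 2)) ≤ (4 * k + 1) * Real.pi / (4 * (2 * k + 1) * W) := by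
        rw [div_le_div_iff₀ (by positivity) (by positivity)]
        have : 0 ≤ (4 * (k : ℝ) + 1) * (4 * (2 * k + 1)) := by positivity
        nlinarith
      have h2 : 1 - 1 / (4 * (k : ℝ) + 1) ≤ (4 * k + 1) / (4 * (2 * k + 1) * (1 / 2)) := by
        rw [sub_le_iff_le_add, div_add_div _ _ (by positivity) (by positivity),
          le_div_iff₀ (by positivity)]
        nlinarith
      linarith
    · have : (4 * k + 1) * Real.pi / (4 * (2 * k + 1) * W) ≤
          (4 * k + 1) * Real.pi / (4 * (2 * k + 1) * (((2 : ℝ) * k + 1) / (2 * k + 2) * (Real.pi / 2))) := by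
        gcongr
      have h2 : (4 * k + 1) * Real.pi / (4 * (2 * k + 1) * (((2 : ℝ) * k + 1) / (2 * k + 2) * (Real.pi / 2)))
          ≤ 1 + 1 / (4 * k + 1) := by
        have : (4 * k + 1) * Real.pi / (4 * (2 * k + 1) * (((2 : ℝ) * k + 1) / (2 * k + 2) * (Real.pi / 2)))
          = (4 * k + 1) * (k + 1) / (2 * k + 1) ^ 2 := by field_simp; norm_num
        rw [this, ← sub_nonneg]
        have : 1 + 1 / (4 * k + 1) - (4 * k + 1) * (k + 1) / (2 * k + 1) ^ 2 =
          (3 * k + 1) / ((4 * k + 1) * (2 * (k : ℝ) + 1) ^ 2) := by field_simp; ring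
        rw [this]
        positivity
      linarith
  have : ν * s - hermiteAmp / m = (hermiteAmp / m) * (ν * s * m / hermiteAmp - 1) := by
    field_simp
  rw [this, abs_mul, abs_of_pos (by positivity)]
  calc hermiteAmp / m * |ν * s * m / hermiteAmp - 1| ≤ 1 / m * m ^ 4 := by gcongr
    _ = m ^ 3 := by field_simp

/-- For odd n = 2k+1 the function vanishes at 0 and its derivative there is 2a_{2k} φ_{2k}(0), so
the same Wallis bounds apply, now with m⁴ = 1/(4k+3). -/
theorem hermiteFun_zero_odd_approx (k : ℕ) :
    |2 * hermiteA (2 * k) * ((-1) ^ k * hermiteFun (2 * k) 0)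
      - hermiteAmp / hermiteScale (2 * k + 1)| ≤ hermiteScale (2 * k + 1) ^ 3 := by
  have h4 := hermiteFun_zero_even_pow k
  have hs := hermiteFun_zero_even_nonneg k
  set s := (-1) ^ k * hermiteFun (2 * k) 0 with hsdef
  have hs4 : s ^ 4 = hermiteFun (2 * k) 0 ^ 4 := by
    rw [hsdef, mul_pow, ← pow_mul, Even.neg_one_pow (by exact ⟨2 * k, by ring⟩), one_mul]
  rw [← hs4] at h4
  have hm := hermiteScale_pos (2 * k + 1)
  have hN := hermiteScale_pow_four (2 * k + 1)
  set m := hermiteScale (2 * k + 1)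
  have ha := hermiteA_pos (2 * k)
  have ha2 := hermiteA_sq (2 * k)
  set a := hermiteA (2 * k)
  have hA := hermiteAmp_pos
  have hA2 := hermiteAmp_sq
  have hA1 := hermiteAmp_le_one
  have hW := Real.Wallis.W_pos k
  have hW1 := Real.Wallis.W_le k
  have hW2 := Real.Wallis.le_W k
  set W := Real.Wallis.W k
  have hπ := Real.pi_pos
  have hk : (0 : ℝ) ≤ k := k.cast_nonneg
  push_cast at hN ha2
  have hr : |2 * a * s * m / hermiteAmp - 1| ≤ m ^ 4 := by
    refine (abs_sub_one_le_abs_pow_four (by positivity)).trans ?_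
    have hm4 : m ^ 4 = 1 / (4 * k + 3) := by
      rw [eq_div_iff (by positivity)]; linarith
    have e : (2 * a * s * m / hermiteAmp) ^ 4 = (2 * k + 1) * Real.pi / ((4 * k + 3) * W) := by
      have hA4 : hermiteAmp ^ 4 = (2 / Real.pi) ^ 2 := by rw [← hA2]; ring
      have hs4' : s ^ 4 = 1 / ((2 * (k : ℝ) + 1) * W * Real.pi) := by
        rw [eq_div_iff (by positivity)]; exact h4
      have ha4 : a ^ 4 = ((2 * (k : ℝ) + 1) / 2) ^ 2 := by rw [← ha2]; ring
      rw [div_pow, mul_pow, mul_pow, mul_pow, ha4, hA4, hs4', hm4]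
      field_simp
    rw [e, hm4, abs_le]
    constructor
    · have : (2 * k + 1) / ((4 * k + 3) * (1 / 2)) ≤ (2 * k + 1) * Real.pi / ((4 * k + 3) * W) := by
        rw [div_le_div_iff₀ (by positivity) (by positivity)]
        have : 0 ≤ (2 * (k : ℝ) + 1) * ((4 * k + 3)) := by positivity
        nlinarith
      have h2 : (2 * k + 1) / ((4 * k + 3) * (1 / 2)) = 1 - 1 / (4 * (k : ℝ) + 3) := by
        field_simp
        ring
      linarith
    · have : (2 * k + 1) * Real.pi / ((4 * k + 3) * W) ≤ (2 * k + 1) * Real.pi /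
          ((4 * k + 3) * (((2 : ℝ) * k + 1) / (2 * k + 2) * (Real.pi / 2))) := by
        gcongr
      have h2 : (2 * k + 1) * Real.pi /
          ((4 * k + 3) * (((2 : ℝ) * k + 1) / (2 * k + 2) * (Real.pi / 2))) =
          1 + 1 / (4 * k + 3) := by field_simp; ring
      linarith
  have : 2 * a * s - hermiteAmp / m = (hermiteAmp / m) * (2 * a * s * m / hermiteAmp - 1) := by
    field_simp
  rw [this, abs_mul, abs_of_pos (by positivity)]
  calc hermiteAmp / m * |2 * a * s * m / hermiteAmp - 1| ≤ 1 / m * m ^ 4 := by gcongr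
    _ = m ^ 3 := by field_simp

theorem zpow_I_two_mul (k : ℕ) : Complex.I ^ (-((2 * k : ℕ) : ℤ)) = (-1) ^ k := by
  rw [zpow_neg, zpow_natCast, pow_mul, Complex.I_sq, ← inv_pow]
  norm_num

/-- The combination φ' + iνφ treats both parities at once: at 0 it is purely imaginary for even n
and real for odd n, and the factor i · i^{-n} records this together with the sign (-1)^k. -/
theorem hermiteFun_zero_approx (n : ℕ) :
    ‖((hermiteFunDeriv n 0 : ℝ) : ℂ) + Complex.I * (Real.sqrt (2 * (n : ℝ) + 1) : ℂ) *
      (hermiteFun n 0 : ℂ) - Complex.I * ((hermiteAmp / hermiteScale n : ℝ) : ℂ) *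
        Complex.I ^ (-(n : ℤ))‖ ≤ hermiteScale n ^ 3 := by
  obtain ⟨k, rfl | rfl⟩ := Nat.even_or_odd' n
  · have h := hermiteFun_zero_even_approx k
    have hd : hermiteFunDeriv (2 * k) 0 = 0 := by
      simp [hermiteFunDeriv, hermiteFun_zero_odd]
    have hI := zpow_I_two_mul k
    rw [hI, hd]
    refine le_trans (le_of_eq ?_) h
    set ν := Real.sqrt (2 * ((2 * k : ℕ) : ℝ) + 1)
    have h1 : ((-1 : ℂ) ^ k) * (-1) ^ k = 1 := by
      rw [← mul_pow]; norm_num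
    have e : ((0 : ℝ) : ℂ) + Complex.I * (ν : ℂ) * (hermiteFun (2 * k) 0 : ℂ)
        - Complex.I * ((hermiteAmp / hermiteScale (2 * k) : ℝ) : ℂ) * (-1) ^ k =
        Complex.I * (-1) ^ k * ((ν * ((-1) ^ k * hermiteFun (2 * k) 0)
          - hermiteAmp / hermiteScale (2 * k) : ℝ) : ℂ) := by
      push_cast
      linear_combination (-Complex.I * ν * hermiteFun (2 * k) 0) * h1
    rw [e, norm_mul, Complex.norm_real]
    simp
  · have h := hermiteFun_zero_odd_approx k
    have hd : hermiteFunDeriv (2 * k + 1) 0 = 2 * hermiteA (2 * k) * hermiteFun (2 * k) 0 := by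
      have := hermiteFun_succ (2 * k) 0
      simp only [hermiteFunDeriv, hermiteFun_zero_odd]
      linear_combination -2 * this
    have hI : Complex.I * Complex.I ^ (-((2 * k + 1 : ℕ) : ℤ)) = (-1) ^ k := by
      rw [← zpow_I_two_mul, ← zpow_one_add₀ Complex.I_ne_zero]
      congr 1
      push_cast
      ring
    rw [hd, hermiteFun_zero_odd]
    refine le_trans (le_of_eq ?_) h
    have h1 : ((-1 : ℂ) ^ k) * (-1) ^ k = 1 := by
      rw [← mul_pow]; norm_num
    set ν := Real.sqrt (2 * ((2 * k + 1 : ℕ) : ℝ) + 1)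
    have e : ((2 * hermiteA (2 * k) * hermiteFun (2 * k) 0 : ℝ) : ℂ) +
        Complex.I * (ν : ℂ) * ((0 : ℝ) : ℂ)
        - Complex.I * ((hermiteAmp / hermiteScale (2 * k + 1) : ℝ) : ℂ) *
          Complex.I ^ (-((2 * k + 1 : ℕ) : ℤ)) =
        (-1) ^ k * ((2 * hermiteA (2 * k) * ((-1) ^ k * hermiteFun (2 * k) 0)
          - hermiteAmp / hermiteScale (2 * k + 1) : ℝ) : ℂ) := by
      push_cast
      push_cast at hI
      linear_combination (-2 * hermiteA (2 * k) * hermiteFun (2 * k) 0) * h1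
        - ((hermiteAmp / hermiteScale (2 * k + 1) : ℂ)) * hI
    rw [e, norm_mul, Complex.norm_real]
    simp

/-! ### Energy bound and oscillatory asymptotics on compact sets. -/

theorem le_mul_exp_of_abs_deriv_le {f f' : ℝ → ℝ} {K R : ℝ} (hf : ∀ x, HasDerivAt f (f' x) x)
    (h0 : ∀ x, 0 ≤ f x) (hb : ∀ x, |x| ≤ R → |f' x| ≤ K * f x) {x : ℝ} (hx : |x| ≤ R) :
    f x ≤ f 0 * Real.exp (K * |x|) := by
  have key : ∀ (g g' : ℝ → ℝ), (∀ x, HasDerivAt g (g' x) x) → (∀ x, 0 ≤ g x) →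
      (∀ x, |x| ≤ R → |g' x| ≤ K * g x) → ∀ x, 0 ≤ x → x ≤ R → g x ≤ g 0 * Real.exp (K * x) := by
    intro g g' hg hg0 hgb x hx0 hxR
    have := norm_le_gronwallBound_of_norm_deriv_right_le (f := g) (f' := g') (δ := g 0) (K := K)
      (ε := 0) (a := 0) (b := R) (fun y _ => (hg y).continuousAt.continuousWithinAt)
      (fun y _ => (hg y).hasDerivWithinAt) (by simp [abs_of_nonneg (hg0 0)])
      (fun y hy => by
        have := hgb y (by rw [abs_of_nonneg hy.1]; exact hy.2.le)
        simpa [abs_of_nonneg (hg0 y)] using this) x ⟨hx0, hxR⟩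
    rw [gronwallBound_ε0, sub_zero, Real.norm_eq_abs, abs_of_nonneg (hg0 x)] at this
    exact this
  rcases le_total 0 x with h | h
  · rw [abs_of_nonneg h] at hx ⊢
    exact key f f' hf h0 hb x h hx
  · rw [abs_of_nonpos h] at hx ⊢
    have := key (fun y => f (-y)) (fun y => -f' (-y)) (fun y => by
      have := (hf (-y)).scomp y (hasDerivAt_neg y)
      simpa [Function.comp_def] using this) (fun y => h0 _)
      (fun y hy => by simpa using hb (-y) (by simpa using hy)) (-x) (by linarith) hx
    simpa using this

/-- The energy φ'² + (2n+1)φ² has derivative 2x²φφ', which on |x| ≤ R is at most R² times the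
energy, so Gronwall bounds its growth independently of n. At 0 the energy is |φ' + iνφ|² ≤ (2/m)²;
dividing by 2n+1 = m⁻⁴ gives φ² = O(m²). -/
theorem exists_abs_hermiteFun_le (R : ℝ) :
    ∃ C, 0 ≤ C ∧ ∀ n x, |x| ≤ R → |hermiteFun n x| ≤ C * hermiteScale n := by
  refine ⟨Real.sqrt (4 * Real.exp (R ^ 2 * R)), Real.sqrt_nonneg _, fun n x hx => ?_⟩
  have hm := hermiteScale_pos n
  have hm1 := hermiteScale_le_one n
  have hν := sqrt_mul_hermiteScale_sq n
  have hz := hermiteFun_zero_approx n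
  have hN1 : (1 : ℝ) ≤ 2 * (n : ℝ) + 1 := by
    have : (0 : ℝ) ≤ n := n.cast_nonneg
    linarith
  have hN := hermiteScale_pow_four n
  have hsq := Real.sq_sqrt (show (0 : ℝ) ≤ 2 * (n : ℝ) + 1 by positivity)
  have hν1 : 1 ≤ Real.sqrt (2 * (n : ℝ) + 1) := Real.one_le_sqrt.2 hN1
  set ν := Real.sqrt (2 * (n : ℝ) + 1)
  set m := hermiteScale n
  have hE := le_mul_exp_of_abs_deriv_le
    (f := fun x => hermiteFunDeriv n x ^ 2 + (2 * (n : ℝ) + 1) * hermiteFun n x ^ 2)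
    (f' := fun x => 2 * x ^ 2 * hermiteFun n x * hermiteFunDeriv n x) (K := R ^ 2) (R := R)
    (fun x => by
      have h1 := (hasDerivAt_hermiteFunDeriv n x).pow 2
      have h2 := ((hasDerivAt_hermiteFun n x).pow 2).const_mul (2 * (n : ℝ) + 1)
      refine (h1.add h2).congr_deriv ?_
      simp
      ring)
    (fun x => by positivity)
    (fun x hx => by
      have hx2 : x ^ 2 ≤ R ^ 2 := sq_le_sq' (by linarith [abs_le.1 hx]) (abs_le.1 hx).2
      set u := hermiteFun n x
      set v := hermiteFunDeriv n x
      have h1 : |2 * u * v| ≤ v ^ 2 + (2 * (n : ℝ) + 1) * u ^ 2 := by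
        rw [abs_le]
        constructor <;> nlinarith [sq_nonneg (u + v), sq_nonneg (u - v), sq_nonneg u]
      have h2 : |2 * x ^ 2 * u * v| = x ^ 2 * |2 * u * v| := by
        rw [show 2 * x ^ 2 * u * v = x ^ 2 * (2 * u * v) by ring, abs_mul, abs_of_nonneg (sq_nonneg x)]
      rw [h2]
      gcongr) hx
  have hp0 : hermiteFunDeriv n 0 ^ 2 + (2 * (n : ℝ) + 1) * hermiteFun n 0 ^ 2 ≤ 4 / m ^ 2 := by
    have e : hermiteFunDeriv n 0 ^ 2 + (2 * (n : ℝ) + 1) * hermiteFun n 0 ^ 2 =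
        ‖((hermiteFunDeriv n 0 : ℝ) : ℂ) + Complex.I * (ν : ℂ) * (hermiteFun n 0 : ℂ)‖ ^ 2 := by
      rw [← Complex.normSq_eq_norm_sq, Complex.normSq_apply]
      simp
      rw [← hsq]
      ring
    rw [e]
    have h1 : ‖Complex.I * ((hermiteAmp / m : ℝ) : ℂ) * Complex.I ^ (-(n : ℤ))‖ ≤ 1 / m := by
      rw [norm_mul, norm_mul, Complex.norm_real, norm_zpow, Complex.norm_I, one_zpow, one_mul,
        mul_one, Real.norm_eq_abs, abs_of_pos (div_pos hermiteAmp_pos hm)]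
      have := hermiteAmp_le_one
      gcongr
    have h2 : m ^ 3 ≤ 1 / m := by
      rw [le_div_iff₀ hm]
      calc m ^ 3 * m = m ^ 4 := by ring
        _ ≤ 1 := pow_le_one₀ hm.le hm1
    have h3 := norm_le_norm_add_norm_sub'
      (((hermiteFunDeriv n 0 : ℝ) : ℂ) + Complex.I * (ν : ℂ) * (hermiteFun n 0 : ℂ))
      (Complex.I * ((hermiteAmp / m : ℝ) : ℂ) * Complex.I ^ (-(n : ℤ)))
    calc _ ≤ (1 / m + 1 / m) ^ 2 := by gcongr; linarith
      _ = 4 / m ^ 2 := by field_simp; norm_num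
  have hexp : Real.exp (R ^ 2 * |x|) ≤ Real.exp (R ^ 2 * R) := by
    gcongr
  have hfin : (2 * (n : ℝ) + 1) * hermiteFun n x ^ 2 ≤ 4 / m ^ 2 * Real.exp (R ^ 2 * R) := by
    calc _ ≤ hermiteFunDeriv n x ^ 2 + (2 * (n : ℝ) + 1) * hermiteFun n x ^ 2 := by
          nlinarith [sq_nonneg (hermiteFunDeriv n x)]
      _ ≤ _ := hE
      _ ≤ _ := by gcongr
  apply abs_le_of_sq_le_sq _ (by positivity)
  rw [mul_pow, Real.sq_sqrt (by positivity)]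
  calc hermiteFun n x ^ 2 = m ^ 4 * ((2 * (n : ℝ) + 1) * hermiteFun n x ^ 2) := by
        linear_combination (-hermiteFun n x ^ 2) * hN
    _ ≤ m ^ 4 * (4 / m ^ 2 * Real.exp (R ^ 2 * R)) := by gcongr
    _ = 4 * Real.exp (R ^ 2 * R) * m ^ 2 := by field_simp

/-- The leading term of the asymptotics of `hermiteFun n` on compact sets, as `n → ∞`. -/
def hermiteWave (n : ℕ) (x : ℝ) : ℂ :=
  ((Real.sqrt (2 * Real.pi))⁻¹ : ℂ) * (hermiteScale n : ℂ) *
    (Complex.I ^ (-(n : ℤ)) * Complex.exp (Complex.I * Real.sqrt (2 * (n : ℝ) + 1) * x) +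
      Complex.I ^ (n : ℤ) * Complex.exp (-(Complex.I * Real.sqrt (2 * (n : ℝ) + 1) * x)))

theorem hermiteAmp_div_two : hermiteAmp / 2 = (Real.sqrt (2 * Real.pi))⁻¹ := by
  have hπ := Real.pi_pos
  have h1 : (Real.sqrt (2 * Real.pi))⁻¹ = Real.sqrt ((2 * Real.pi)⁻¹) := (Real.sqrt_inv _).symm
  have := hermiteAmp_sq
  have h0 := hermiteAmp_pos
  rw [h1, eq_comm, Real.sqrt_eq_iff_mul_self_eq (by positivity) (by positivity), eq_comm]
  calc hermiteAmp / 2 * (hermiteAmp / 2) = hermiteAmp ^ 2 / 4 := by ring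
    _ = _ := by rw [this]; field_simp; norm_num

/-- Puts the wave in the form m² Im(e^{iνx} P), parallel to φ = m² Im(φ' + iνφ), which holds because
m²ν = 1. Comparing φ with the wave then amounts to comparing e^{-iνx}(φ' + iνφ) with the constant P.
-/
theorem hermiteWave_eq (n : ℕ) (x : ℝ) : hermiteWave n x = ((hermiteScale n ^ 2 *
    (Complex.exp (Complex.I * Real.sqrt (2 * (n : ℝ) + 1) * x) *
      (Complex.I * ((hermiteAmp / hermiteScale n : ℝ) : ℂ) * Complex.I ^ (-(n : ℤ)))).im : ℝ) : ℂ) := by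
  have hm : (hermiteScale n : ℂ) ≠ 0 := by exact_mod_cast (hermiteScale_pos n).ne'
  set z := Complex.exp (Complex.I * Real.sqrt (2 * (n : ℝ) + 1) * x) *
      (Complex.I * ((hermiteAmp / hermiteScale n : ℝ) : ℂ) * Complex.I ^ (-(n : ℤ)))
  have h1 : (z.im : ℂ) = (z - (starRingEnd ℂ) z) / (2 * Complex.I) := Complex.im_eq_sub_conj z
  have h2 : (starRingEnd ℂ) z = Complex.exp (-(Complex.I * Real.sqrt (2 * (n : ℝ) + 1) * x)) *
      (-Complex.I * ((hermiteAmp / hermiteScale n : ℝ) : ℂ) * Complex.I ^ (n : ℤ)) := by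
    simp only [z, map_mul, ← Complex.exp_conj, Complex.conj_ofReal, Complex.conj_I, map_zpow₀]
    congr 2
    · ring_nf
    · rw [zpow_neg, ← inv_zpow, Complex.inv_def]
      simp
  push_cast
  rw [h1, h2]
  have h3 : ((Real.sqrt (2 * Real.pi))⁻¹ : ℂ) = (hermiteAmp : ℂ) / 2 := by
    rw [← Complex.ofReal_inv, ← hermiteAmp_div_two]
    push_cast
    rfl
  simp only [z, hermiteWave]
  rw [h3]
  have := Complex.I_ne_zero
  push_cast
  field_simp
  ring

/-- Variation of constants: p = e^{-iνx}(φ' + iνφ) would be constant for the free equation φ'' =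
-ν²φ, and here p' = e^{-iνx}x²φ. The a priori bound makes p' = O(m) on [-R, R], so p stays within
O(m) of p(0), which is within m³ of P. The prefactor m² turns this into O(m³). -/
theorem exists_norm_hermiteFun_sub_wave_le {R : ℝ} (hR : 0 ≤ R) : ∃ C, 0 ≤ C ∧ ∀ n x, |x| ≤ R →
    ‖(hermiteFun n x : ℂ) - hermiteWave n x‖ ≤ C * hermiteScale n ^ 3 := by
  obtain ⟨C, hC0, hC⟩ := exists_abs_hermiteFun_le R
  refine ⟨R ^ 2 * C * R + 1, by positivity, fun n x hx => ?_⟩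
  have hm := hermiteScale_pos n
  have hm1 := hermiteScale_le_one n
  have hν := sqrt_mul_hermiteScale_sq n
  have hz := hermiteFun_zero_approx n
  have hsq := Real.sq_sqrt (show (0 : ℝ) ≤ 2 * (n : ℝ) + 1 by positivity)
  rw [hermiteWave_eq]
  set ν := Real.sqrt (2 * (n : ℝ) + 1)
  set m := hermiteScale n
  set P := Complex.I * ((hermiteAmp / m : ℝ) : ℂ) * Complex.I ^ (-(n : ℤ))
  let w : ℝ → ℂ := fun x => ((hermiteFunDeriv n x : ℝ) : ℂ) + Complex.I * (ν : ℂ) * (hermiteFun n x : ℂ)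
  let p : ℝ → ℂ := fun x => Complex.exp (-(Complex.I * ν * x)) * w x
  have hp : ∀ y : ℝ, HasDerivAt p (Complex.exp (-(Complex.I * ν * y)) * (y ^ 2 * hermiteFun n y)) y := by
    intro y
    have h1 : HasDerivAt (fun y : ℝ => -(Complex.I * ν * y)) (-(Complex.I * ν)) y := by
      simpa using! ((Complex.ofRealCLM.hasDerivAt (x := y)).const_mul (Complex.I * ν)).neg
    have h2 := (hasDerivAt_hermiteFunDeriv n y).ofReal_comp
    have h3 := ((hasDerivAt_hermiteFun n y).ofReal_comp).const_mul (Complex.I * ν)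
    refine (h1.cexp.mul (h2.add h3)).congr_deriv ?_
    have hsq' : (ν : ℂ) ^ 2 = 2 * (n : ℂ) + 1 := by exact_mod_cast hsq
    push_cast
    simp only [Pi.add_apply]
    linear_combination (-Complex.exp (-(Complex.I * ν * y)) * hermiteFun n y * ν ^ 2) * Complex.I_sq +
      (Complex.exp (-(Complex.I * ν * y)) * hermiteFun n y) * hsq'
  have hE : ∀ y : ℝ, ‖Complex.exp (-(Complex.I * ν * y))‖ = 1 := by
    intro y
    rw [Complex.norm_exp]
    simp
  have hE' : ∀ y : ℝ, ‖Complex.exp (Complex.I * ν * y)‖ = 1 := by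
    intro y
    rw [Complex.norm_exp]
    simp
  have hdiff : ‖p x - p 0‖ ≤ R ^ 2 * (C * m) * R := by
    have := Convex.norm_image_sub_le_of_norm_hasDerivWithin_le (f := p) (s := Set.Icc (-R) R)
      (x := 0) (y := x) (C := R ^ 2 * (C * m)) (fun y _ => (hp y).hasDerivWithinAt)
      (fun y hy => by
        have hy' : |y| ≤ R := abs_le.2 hy
        rw [norm_mul, hE, one_mul, norm_mul, norm_pow, Complex.norm_real, Complex.norm_real,
          Real.norm_eq_abs, Real.norm_eq_abs]
        have := hC n y hy'
        gcongr) (convex_Icc _ _) ⟨by linarith, hR⟩ (abs_le.1 hx)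
    refine this.trans ?_
    rw [sub_zero, Real.norm_eq_abs]
    gcongr
  have hp0 : ‖p 0 - P‖ ≤ m ^ 3 := by
    have : p 0 = ((hermiteFunDeriv n 0 : ℝ) : ℂ) + Complex.I * (ν : ℂ) * (hermiteFun n 0 : ℂ) := by
      simp [p, w]
    rw [this]
    exact hz
  have hh : hermiteFun n x = m ^ 2 * (Complex.exp (Complex.I * ν * x) * p x).im := by
    have : Complex.exp (Complex.I * ν * x) * p x = w x := by
      simp only [p]
      rw [← mul_assoc, ← Complex.exp_add]
      simp
    rw [this]
    simp only [w]
    simp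
    linear_combination (-hermiteFun n x) * hν
  rw [hh, ← Complex.ofReal_sub, ← mul_sub, ← Complex.sub_im, ← mul_sub, Complex.norm_real, norm_mul]
  have h1 : ‖p x - P‖ ≤ R ^ 2 * (C * m) * R + m ^ 3 := by
    have : p x - P = (p x - p 0) + (p 0 - P) := by ring
    rw [this]
    exact (norm_add_le _ _).trans (add_le_add hdiff hp0)
  have h2 : ‖(Complex.exp (Complex.I * ν * x) * (p x - P)).im‖ ≤ R ^ 2 * (C * m) * R + m ^ 3 := by
    refine (Complex.abs_im_le_norm _).trans ?_
    rw [norm_mul, hE', one_mul]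
    exact h1
  have h3 : m ^ 3 ≤ m := by
    calc m ^ 3 = m ^ 2 * m := by ring
      _ ≤ 1 * m := by gcongr; exact pow_le_one₀ hm.le hm1
      _ = m := one_mul m
  rw [Real.norm_of_nonneg (by positivity : (0 : ℝ) ≤ m ^ 2)]
  calc _ ≤ m ^ 2 * (R ^ 2 * (C * m) * R + m) := by gcongr; linarith
    _ = _ := by ring

/-! ### Completeness of the Hermite functions -/

open scoped FourierTransform SchwartzMap in
-- By duality: a test function is the Fourier transform of some Schwartz ψ, and ∫ 𝓕ψ · G = ∫ ψ · 𝓕G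
-- = 0.
theorem ae_eq_zero_of_fourier_eq_zero {G : ℝ → ℂ} (hG : Integrable G)
    (h : ∀ ξ : ℝ, ∫ x : ℝ, Complex.exp (-(Complex.I * ξ * x)) * G x = 0) :
    ∀ᵐ x, G x = 0 := by
  have hF : ∀ w : ℝ, 𝓕 G w = 0 := by
    intro w
    rw [Real.fourier_real_eq_integral_exp_smul, ← h (2 * Real.pi * w)]
    congr 1
    ext x
    rw [smul_eq_mul]
    congr 2
    push_cast
    ring
  refine ae_eq_zero_of_integral_contDiff_smul_eq_zero hG.locallyIntegrable fun φ hφ hφc => ?_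
  let Φ : 𝓢(ℝ, ℂ) := HasCompactSupport.toSchwartzMap (f := fun x => (φ x : ℂ))
    (hφc.comp_left Complex.ofReal_zero) (Complex.ofRealCLM.contDiff.comp hφ)
  obtain ⟨ψ, hψ⟩ : ∃ ψ : 𝓢(ℝ, ℂ), 𝓕 ψ = Φ := ⟨𝓕⁻ Φ, FourierTransform.fourier_fourierInv_eq Φ⟩
  have h2 : ∫ ξ, 𝓕 ψ ξ • G ξ = ∫ x, ψ x • 𝓕 G x := by
    simpa using! VectorFourier.integral_fourierIntegral_smul_eq_flip (L := innerₗ ℝ)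
      Real.continuous_fourierChar continuous_inner (ψ.integrable (μ := volume)) hG
  rw [hψ] at h2
  simp only [hF, smul_zero, integral_zero] at h2
  rw [← h2]
  rfl

/-- Expand e^{-iξx} in its power series and integrate term by term; e^{|ξx|}|G| dominates the
partial sums. -/
theorem fourier_eq_zero_of_moments {G : ℝ → ℂ} (hG : AEStronglyMeasurable G)
    (hexp : ∀ c : ℝ, Integrable fun x => Real.exp (c * |x|) * ‖G x‖)
    (hm : ∀ k : ℕ, ∫ x : ℝ, (x : ℂ) ^ k * G x = 0) (ξ : ℝ) :
    ∫ x : ℝ, Complex.exp (-(Complex.I * ξ * x)) * G x = 0 := by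
  have hsum : ∀ x : ℝ, HasSum (fun k : ℕ => (|ξ| * |x|) ^ k / (k.factorial : ℝ) * ‖G x‖)
      (Real.exp (|ξ| * |x|) * ‖G x‖) := by
    intro x
    have := NormedSpace.expSeries_div_hasSum_exp (𝔸 := ℝ) (|ξ| * |x|)
    rw [← Real.exp_eq_exp_ℝ] at this
    exact this.mul_right _
  have key := hasSum_integral_of_dominated_convergence
    (F := fun (k : ℕ) (x : ℝ) => (-(Complex.I * ξ * x)) ^ k / (k.factorial : ℂ) * G x)
    (f := fun x => Complex.exp (-(Complex.I * ξ * x)) * G x) (μ := volume)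
    (fun k x => (|ξ| * |x|) ^ k / (k.factorial : ℝ) * ‖G x‖)
    (fun k => by
      have : Continuous fun x : ℝ => (-(Complex.I * ξ * x)) ^ k / (k.factorial : ℂ) := by fun_prop
      exact this.aestronglyMeasurable.mul hG)
    (fun k => ae_of_all _ fun x => by simp)
    (ae_of_all _ fun x => (hsum x).summable)
    (by
      refine (hexp |ξ|).congr (ae_of_all _ fun x => ?_)
      exact (hsum x).tsum_eq.symm)
    (ae_of_all _ fun x => by
      have := NormedSpace.expSeries_div_hasSum_exp (𝔸 := ℂ) (-(Complex.I * ξ * x))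
      rw [← Complex.exp_eq_exp_ℂ] at this
      exact this.mul_right _)
  have hz : ∀ k : ℕ, ∫ x : ℝ, (-(Complex.I * ξ * x)) ^ k / (k.factorial : ℂ) * G x = 0 := by
    intro k
    have : ∀ x : ℝ, (-(Complex.I * ξ * x)) ^ k / (k.factorial : ℂ) * G x =
        (-(Complex.I * ξ)) ^ k / (k.factorial : ℂ) * ((x : ℂ) ^ k * G x) := by
      intro x
      rw [← neg_mul, mul_pow]
      ring
    simp_rw [this]
    rw [integral_const_mul, hm, mul_zero]
  simp_rw [hz] at key
  exact key.unique hasSum_zero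

theorem memLp_eval_mul_gauss (p : Polynomial ℝ) :
    MemLp (fun x : ℝ => ((p.eval x * Real.exp (-x ^ 2 / 2) : ℝ) : ℂ)) 2 (volume : Measure ℝ) := by
  have hc : Continuous fun x : ℝ => ((p.eval x * Real.exp (-x ^ 2 / 2) : ℝ) : ℂ) := by
    have := p.continuous
    fun_prop
  rw [memLp_two_iff_integrable_sq_norm hc.aestronglyMeasurable]
  refine (integrable_eval_mul_gauss (p * p)).congr (ae_of_all _ fun x => ?_)
  have h1 : Real.exp (-x ^ 2 / 2) * Real.exp (-x ^ 2 / 2) = Real.exp (-x ^ 2) := by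
    rw [← Real.exp_add]
    congr 1
    ring
  simp only [Complex.norm_real, Real.norm_eq_abs, sq_abs, Polynomial.eval_mul]
  rw [← h1]
  ring

theorem memLp_pow_mul_hermiteFun (k n : ℕ) :
    MemLp (fun x : ℝ => (x : ℂ) ^ k * (hermiteFun n x : ℂ)) 2 (volume : Measure ℝ) := by
  refine ((memLp_eval_mul_gauss (Polynomial.C (Real.pi ^ (-(1 / 4) : ℝ)) *
    (Polynomial.X ^ k * hermiteH n))).ae_eq (ae_of_all _ fun x => ?_))
  simp only [hermiteFun, Polynomial.eval_mul, Polynomial.eval_C, Polynomial.eval_pow,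
    Polynomial.eval_X]
  push_cast
  ring

theorem memLp_exp_abs_mul_gauss (c : ℝ) (k : ℕ) :
    MemLp (fun x : ℝ => |x| ^ k * (Real.exp (c * |x|) * Real.exp (-x ^ 2 / 2))) 2
      (volume : Measure ℝ) := by
  have hc : Continuous fun x : ℝ => |x| ^ k * (Real.exp (c * |x|) * Real.exp (-x ^ 2 / 2)) := by
    fun_prop
  rw [memLp_two_iff_integrable_sq_norm hc.aestronglyMeasurable]
  -- After squaring, the exponent satisfies 2c|x| - x² ≤ 2c² - x²/2, by (2c - |x|)² ≥ 0.
  have hi := (integrable_rpow_mul_exp_neg_mul_sq (b := 1 / 2) (by norm_num) (s := ((2 * k : ℕ) : ℝ))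
      (by have : (0 : ℝ) ≤ ((2 * k : ℕ) : ℝ) := Nat.cast_nonneg _
          linarith)).const_mul (Real.exp (2 * c ^ 2))
  refine hi.mono' (by fun_prop) (ae_of_all _ fun x => ?_)
  rw [Real.rpow_natCast, pow_mul x 2 k, Real.norm_eq_abs, abs_of_nonneg (by positivity),
    Real.norm_eq_abs, sq_abs, mul_pow, ← pow_mul, mul_comm k 2, pow_mul, sq_abs, mul_left_comm]
  gcongr
  rw [← Real.exp_add, ← Real.exp_add, ← Real.exp_nat_mul]
  apply Real.exp_le_exp.2
  push_cast
  nlinarith [sq_nonneg (2 * c - |x|), sq_abs x]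

theorem X_mul_hermiteFun_succ (n : ℕ) (x : ℝ) : x * hermiteFun (n + 1) x =
    hermiteA n * hermiteFun n x + hermiteA (n + 1) * hermiteFun (n + 2) x := by
  rw [hermiteFun_succ]
  ring

theorem integrable_pow_mul_hermiteFun_mul {w : ℝ → ℂ} (hw : MemLp w 2 (volume : Measure ℝ))
    (k n : ℕ) : Integrable fun x : ℝ => (x : ℂ) ^ k * (hermiteFun n x : ℂ) * w x :=
  (memLp_pow_mul_hermiteFun k n).integrable_mul hw

/-- The product x·u need not lie in L², so completeness alone would not suffice. Instead the
recurrence carries the vanishing integrals from φ_n to x^k φ_n; with n = 0 all moments of G =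
e^{-x²/2}(xu - v) vanish, and the Gaussian factor gives G the exponential integrability that forces
G = 0. The case u = 0 is completeness of the Hermite functions; general u diagonalizes J on its
maximal domain. -/
theorem ae_eq_of_integral_hermiteFun {u v : ℝ → ℂ} (hu : MemLp u 2 (volume : Measure ℝ))
    (hv : MemLp v 2 (volume : Measure ℝ))
    (h : ∀ n, ∫ x : ℝ, (hermiteFun n x : ℂ) * (x * u x - v x) = 0) :
    ∀ᵐ x : ℝ, (x : ℂ) * u x = v x := by
  have hint : ∀ k n, Integrable fun x : ℝ => (x : ℂ) ^ k * (hermiteFun n x : ℂ) * (x * u x - v x) := by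
    intro k n
    refine ((integrable_pow_mul_hermiteFun_mul hu (k + 1) n).sub
      (integrable_pow_mul_hermiteFun_mul hv k n)).congr (ae_of_all _ fun x => ?_)
    simp only [Pi.sub_apply]
    ring
  have hmom : ∀ k n, ∫ x : ℝ, (x : ℂ) ^ k * (hermiteFun n x : ℂ) * (x * u x - v x) = 0 := by
    intro k
    induction k with
    | zero => simpa using h
    | succ k ih =>
      intro n
      cases n with
      | zero =>
        have e : ∀ x : ℝ, (x : ℂ) ^ (k + 1) * (hermiteFun 0 x : ℂ) * (x * u x - v x) =
            (hermiteA 0 : ℂ) * ((x : ℂ) ^ k * (hermiteFun 1 x : ℂ) * (x * u x - v x)) := by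
          intro x
          have : (hermiteA 0 : ℂ) * hermiteFun 1 x = x * hermiteFun 0 x := by
            exact_mod_cast hermiteFun_one x
          linear_combination (-(x : ℂ) ^ k * (x * u x - v x)) * this
        simp_rw [e]
        rw [integral_const_mul, ih, mul_zero]
      | succ n =>
        have e : ∀ x : ℝ, (x : ℂ) ^ (k + 1) * (hermiteFun (n + 1) x : ℂ) * (x * u x - v x) =
            (hermiteA n : ℂ) * ((x : ℂ) ^ k * (hermiteFun n x : ℂ) * (x * u x - v x)) +
            (hermiteA (n + 1) : ℂ) * ((x : ℂ) ^ k * (hermiteFun (n + 2) x : ℂ) * (x * u x - v x)) := by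
          intro x
          have : (x : ℂ) * hermiteFun (n + 1) x =
              hermiteA n * hermiteFun n x + hermiteA (n + 1) * hermiteFun (n + 2) x := by
            exact_mod_cast X_mul_hermiteFun_succ n x
          linear_combination ((x : ℂ) ^ k * (x * u x - v x)) * this
        simp_rw [e]
        rw [integral_add ((hint k n).const_mul _) ((hint k (n + 2)).const_mul _),
          integral_const_mul, integral_const_mul, ih, ih, mul_zero, mul_zero, add_zero]
  have hG : AEStronglyMeasurable (fun x : ℝ => (Real.exp (-x ^ 2 / 2) : ℂ) * (x * u x - v x)) := by
    have h1 : Continuous fun x : ℝ => (Real.exp (-x ^ 2 / 2) : ℂ) := by fun_prop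
    have h2 : Continuous fun x : ℝ => (x : ℂ) := by fun_prop
    exact h1.aestronglyMeasurable.mul ((h2.aestronglyMeasurable.mul hu.1).sub hv.1)
  have hexp : ∀ c : ℝ, Integrable fun x : ℝ =>
      Real.exp (c * |x|) * ‖(Real.exp (-x ^ 2 / 2) : ℂ) * (x * u x - v x)‖ := by
    intro c
    have i1 := (memLp_exp_abs_mul_gauss c 1).integrable_mul hu.norm
    have i0 := (memLp_exp_abs_mul_gauss c 0).integrable_mul hv.norm
    have hc : Continuous fun x : ℝ => Real.exp (c * |x|) := by fun_prop
    refine (i1.add i0).mono' (hc.aestronglyMeasurable.mul hG.norm) (ae_of_all _ fun x => ?_)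
    have h1 : ‖(x : ℂ) * u x - v x‖ ≤ |x| * ‖u x‖ + ‖v x‖ := by
      refine (norm_sub_le _ _).trans (le_of_eq ?_)
      rw [norm_mul, Complex.norm_real, Real.norm_eq_abs]
    rw [norm_mul, norm_norm, Real.norm_eq_abs, Real.abs_exp, norm_mul, Complex.norm_real,
      Real.norm_eq_abs, Real.abs_exp]
    calc _ ≤ Real.exp (c * |x|) * (Real.exp (-x ^ 2 / 2) * (|x| * ‖u x‖ + ‖v x‖)) := by gcongr
      _ = _ := by
        simp only [Pi.add_apply, Pi.mul_apply]
        ring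
  have hGint : Integrable (fun x : ℝ => (Real.exp (-x ^ 2 / 2) : ℂ) * (x * u x - v x)) := by
    have := hexp 0
    simp only [zero_mul, Real.exp_zero, one_mul] at this
    exact (integrable_norm_iff hG).1 this
  have hz := ae_eq_zero_of_fourier_eq_zero hGint (fourier_eq_zero_of_moments hG hexp fun k => by
    have hπ : ((Real.pi ^ (-(1 / 4) : ℝ) : ℝ) : ℂ) ≠ 0 := by
      exact_mod_cast (by positivity : Real.pi ^ (-(1 / 4) : ℝ) ≠ 0)
    apply (mul_eq_zero.1 _).resolve_left hπ
    rw [← integral_const_mul, ← hmom k 0]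
    congr 1
    ext x
    have h0 : hermiteH 0 = 1 := rfl
    simp only [hermiteFun, h0, Polynomial.eval_one]
    push_cast
    ring)
  filter_upwards [hz] with x hx
  have : (Real.exp (-x ^ 2 / 2) : ℂ) ≠ 0 := by exact_mod_cast (Real.exp_pos _).ne'
  exact sub_eq_zero.1 ((mul_eq_zero.1 hx).resolve_left this)

/-! ### Φ as a unitary operator that diagonalizes J. -/

theorem inner_hermiteVec (n : ℕ) (u : LTwo) :
    inner ℂ (hermiteVec n) u = ∫ x : ℝ, (hermiteFun n x : ℂ) * u x := by
  rw [L2.inner_def]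
  refine integral_congr_ae ?_
  filter_upwards [(memLp_hermiteFun n).coeFn_toLp] with x hx
  unfold hermiteVec
  rw [hx]
  simp [mul_comm]

theorem orthogonal_span_hermiteVec : (Submodule.span ℂ (Set.range hermiteVec))ᗮ = ⊥ := by
  rw [Submodule.eq_bot_iff]
  intro v hv
  rw [Submodule.mem_orthogonal] at hv
  have h := ae_eq_of_integral_hermiteFun (u := 0) (v := v) MemLp.zero' (Lp.memLp v) (fun n => by
    have := hv (hermiteVec n) (Submodule.subset_span ⟨n, rfl⟩)
    rw [inner_hermiteVec] at this
    simp [integral_neg, this])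
  apply Lp.ext
  filter_upwards [h, Lp.coeFn_zero ℂ 2 (volume : Measure ℝ)] with x hx h0
  rw [h0, ← hx]
  simp

/-- The Hermite functions as a Hilbert basis of `L²(ℝ)`. -/
def hermiteBasis : HilbertBasis ℕ ℂ LTwo :=
  HilbertBasis.mkOfOrthogonalEqBot orthonormal_hermiteVec orthogonal_span_hermiteVec

/-- The map `Φ` as a unitary operator. -/
def hermitePhiEquiv : EllTwo ≃ₗᵢ[ℂ] LTwo := hermiteBasis.repr.symm

theorem hermitePhiEquiv_apply (f : EllTwo) : hermitePhiEquiv f = hermitePhi f := by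
  have h := hermiteBasis.hasSum_repr_symm f
  simp only [hermiteBasis, HilbertBasis.coe_mkOfOrthogonalEqBot] at h
  exact h.unique (hermitePhi_hasSum f)

theorem hermitePhiEquiv_symm_apply (u : LTwo) (n : ℕ) :
    hermitePhiEquiv.symm u n = ∫ x : ℝ, (hermiteFun n x : ℂ) * u x := by
  rw [← inner_hermiteVec]
  have := hermiteBasis.repr_apply_apply u n
  simpa [hermiteBasis, hermitePhiEquiv] using this

theorem integral_hermiteFun_mul_hermitePhiEquiv (f : EllTwo) (n : ℕ) :
    ∫ x : ℝ, (hermiteFun n x : ℂ) * hermitePhiEquiv f x = f n := by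
  rw [← hermitePhiEquiv_symm_apply, LinearIsometryEquiv.symm_apply_apply]

/-- `Φ` transforms the Hermite operator into the multiplication by the independent variable. -/
theorem hermitePhiEquiv_of_jacobiSeq {f h : EllTwo}
    (hfh : ∀ n, h n = jacobiSeq hermiteA hermiteB f n) :
    ∀ᵐ x : ℝ, (x : ℂ) * hermitePhiEquiv f x = hermitePhiEquiv h x := by
  -- Tested against φ_n, with the factor x moved onto φ_n by the recurrence, the claim reduces to
  -- (Jf)_n - h_n = 0.
  refine ae_eq_of_integral_hermiteFun (Lp.memLp _) (Lp.memLp _) fun n => ?_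
  have hi : ∀ (w : LTwo) n, Integrable fun x : ℝ => (hermiteFun n x : ℂ) * w x :=
    fun w n => (memLp_hermiteFun n).integrable_mul (Lp.memLp w)
  cases n with
  | zero =>
    have e : ∀ x : ℝ, (hermiteFun 0 x : ℂ) * (x * hermitePhiEquiv f x - hermitePhiEquiv h x) =
        (hermiteA 0 : ℂ) * ((hermiteFun 1 x : ℂ) * hermitePhiEquiv f x)
          - (hermiteFun 0 x : ℂ) * hermitePhiEquiv h x := by
      intro x
      have : (hermiteA 0 : ℂ) * hermiteFun 1 x = x * hermiteFun 0 x := by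
        exact_mod_cast hermiteFun_one x
      linear_combination (-hermitePhiEquiv f x) * this
    simp_rw [e]
    rw [integral_sub ((hi _ _).const_mul _) (hi _ _), integral_const_mul,
      integral_hermiteFun_mul_hermitePhiEquiv, integral_hermiteFun_mul_hermitePhiEquiv, hfh]
    simp [jacobiSeq, hermiteB]
  | succ n =>
    have e : ∀ x : ℝ, (hermiteFun (n + 1) x : ℂ) * (x * hermitePhiEquiv f x - hermitePhiEquiv h x) =
        (hermiteA n : ℂ) * ((hermiteFun n x : ℂ) * hermitePhiEquiv f x)
          + (hermiteA (n + 1) : ℂ) * ((hermiteFun (n + 2) x : ℂ) * hermitePhiEquiv f x)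
          - (hermiteFun (n + 1) x : ℂ) * hermitePhiEquiv h x := by
      intro x
      have : (x : ℂ) * hermiteFun (n + 1) x =
          hermiteA n * hermiteFun n x + hermiteA (n + 1) * hermiteFun (n + 2) x := by
        exact_mod_cast X_mul_hermiteFun_succ n x
      linear_combination (hermitePhiEquiv f x) * this
    simp_rw [e]
    have hadd : Integrable fun x : ℝ => (hermiteA n : ℂ) * ((hermiteFun n x : ℂ) * hermitePhiEquiv f x)
        + (hermiteA (n + 1) : ℂ) * ((hermiteFun (n + 2) x : ℂ) * hermitePhiEquiv f x) :=
      ((hi _ _).const_mul _).add ((hi _ _).const_mul _)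
    rw [integral_sub hadd (hi _ _),
      integral_add ((hi _ _).const_mul _) ((hi _ _).const_mul _), integral_const_mul,
      integral_const_mul, integral_hermiteFun_mul_hermitePhiEquiv,
      integral_hermiteFun_mul_hermitePhiEquiv, integral_hermiteFun_mul_hermitePhiEquiv, hfh]
    simp [jacobiSeq, hermiteB]

/-! ### Unitary groups -/

namespace IsUnitaryGroupOf

variable {E : Type*} [NormedAddCommGroup E] [InnerProductSpace ℂ E] {A : E →ₗ.[ℂ] E}
  {V W : ℝ → (E ≃ₗᵢ[ℂ] E)}

theorem apply_mem_graph (hW : IsUnitaryGroupOf A W) {x y : E} (h : (x, y) ∈ A.graph) (t : ℝ) :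
    (W t x, W t y) ∈ A.graph := by
  rw [hW.generator] at h ⊢
  refine (((W t).continuous.tendsto y).comp h).congr fun s => ?_
  simp only [Function.comp_apply, map_smul, map_sub]
  rw [← hW.map_add, ← hW.map_add, add_comm]

theorem hasDerivAt (hW : IsUnitaryGroupOf A W) {x y : E} (h : (x, y) ∈ A.graph) (t : ℝ) :
    HasDerivAt (fun t => W t x) (-Complex.I • W t y) t := by
  have h' := (hW.generator _ _).1 (hW.apply_mem_graph h t)
  rw [hasDerivAt_iff_tendsto_slope_zero]
  refine (h'.const_smul (-Complex.I)).congr fun s => ?_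
  rw [smul_smul, ← hW.map_add, add_comm s t]
  have : -Complex.I * (Complex.I / (s : ℂ)) = ((s⁻¹ : ℝ) : ℂ) := by
    push_cast
    rw [mul_div_assoc', neg_mul, Complex.I_mul_I, neg_neg, one_div]
  rw [this, Complex.coe_smul]

/-- Differentiate the constant function ⟨W t x, W t y⟩ at t = 0. -/
theorem inner_symm (hW : IsUnitaryGroupOf A W) {x ax y ay : E} (hx : (x, ax) ∈ A.graph)
    (hy : (y, ay) ∈ A.graph) : inner ℂ ax y = inner ℂ x ay := by
  have h := (hW.hasDerivAt hx 0).inner ℂ (hW.hasDerivAt hy 0)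
  simp only [LinearIsometryEquiv.inner_map_map, hW.map_zero, inner_smul_left, inner_smul_right] at h
  have h0 := h.unique (hasDerivAt_const (0 : ℝ) (inner ℂ x y))
  simp only [map_neg, Complex.conj_I, neg_neg] at h0
  apply mul_left_cancel₀ Complex.I_ne_zero
  linear_combination h0

/-- Symmetry of A makes ⟨V t x, W t x⟩ constant, equal to ‖x‖². As both vectors have norm ‖x‖,
expanding ‖V t x - W t x‖² gives 0. -/
theorem apply_eq (hV : IsUnitaryGroupOf A V) (hW : IsUnitaryGroupOf A W) {x y : E}
    (h : (x, y) ∈ A.graph) (t : ℝ) : V t x = W t x := by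
  have hd : ∀ t, HasDerivAt (fun t => inner ℂ (V t x) (W t x)) 0 t := by
    intro t
    refine ((hV.hasDerivAt h t).inner ℂ (hW.hasDerivAt h t)).congr_deriv ?_
    rw [inner_smul_left, inner_smul_right,
      hV.inner_symm (hV.apply_mem_graph h t) (hW.apply_mem_graph h t)]
    simp
  have hc := is_const_of_deriv_eq_zero (fun t => (hd t).differentiableAt) (fun t => (hd t).deriv) t 0
  simp only [hV.map_zero, hW.map_zero] at hc
  have hn := norm_sub_sq (𝕜 := ℂ) (V t x) (W t x)
  rw [hc, LinearIsometryEquiv.norm_map, LinearIsometryEquiv.norm_map, inner_self_eq_norm_sq] at hn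
  have : ‖V t x - W t x‖ = 0 := by
    apply pow_eq_zero_iff (two_ne_zero) |>.1
    linarith
  exact sub_eq_zero.1 (norm_eq_zero.1 this)

end IsUnitaryGroupOf

/-! ### The domain of the Hermite operator -/

theorem mem_graph_hermiteJ {f h : EllTwo} :
    (f, h) ∈ hermiteJ.graph ↔ ∀ n, h n = jacobiSeq hermiteA hermiteB f n := by
  rw [LinearPMap.mem_graph_iff]
  constructor
  · rintro ⟨y, hy1, hy2⟩ n
    simp only at hy1 hy2
    rw [← hy1, ← hy2]
    rfl
  · intro hfh
    have hm : Memℓp (jacobiSeq hermiteA hermiteB (f : ℕ → ℂ)) 2 := by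
      rw [← funext hfh]
      exact lp.memℓp h
    refine ⟨⟨f, hm⟩, rfl, ?_⟩
    apply lp.ext
    funext n
    exact (hfh n).symm

/-- The standard basis vectors of `ℓ²(ℤ₊)`. -/
def ellE (n : ℕ) : EllTwo := lp.single 2 n (1 : ℂ)

/-- The images of the standard basis vectors under the Hermite operator. -/
def hermiteJE : ℕ → EllTwo
  | 0 => (hermiteA 0 : ℂ) • ellE 1
  | n + 1 => (hermiteA n : ℂ) • ellE n + (hermiteA (n + 1) : ℂ) • ellE (n + 2)

theorem ellE_apply (n m : ℕ) : ellE n m = if m = n then 1 else 0 := by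
  simp [ellE, lp.single_apply, Pi.single_apply]

theorem ellE_mem_graph (n : ℕ) : (ellE n, hermiteJE n) ∈ hermiteJ.graph := by
  rw [mem_graph_hermiteJ]
  intro m
  cases n <;> cases m <;>
    simp only [hermiteJE, jacobiSeq, hermiteB, lp.coeFn_add, lp.coeFn_smul, Pi.add_apply,
      Pi.smul_apply, ellE_apply, smul_eq_mul, Complex.ofReal_zero] <;> grind

theorem inner_ellE (n : ℕ) (f : EllTwo) : inner ℂ (ellE n) f = f n := by
  rw [ellE, lp.inner_single_left]
  simp

theorem inner_hermiteJE (n : ℕ) (f : EllTwo) :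
    inner ℂ (hermiteJE n) f = jacobiSeq hermiteA hermiteB f n := by
  cases n <;> simp [hermiteJE, jacobiSeq, hermiteB, inner_ellE]

theorem linearIsometryEquiv_ext_ellE {V W : EllTwo ≃ₗᵢ[ℂ] EllTwo} (h : ∀ n, V (ellE n) = W (ellE n)) :
    V = W := by
  ext1 f
  have hs := lp.hasSum_single (p := 2) (by norm_num) f
  have e : ∀ n, lp.single 2 n (f n) = f n • ellE n := by
    intro n
    rw [ellE, ← lp.single_smul]
    simp
  simp_rw [e] at hs
  have h1 := hs.mapL (V : EllTwo →L[ℂ] EllTwo)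
  have h2 := hs.mapL (W : EllTwo →L[ℂ] EllTwo)
  have e2 : ∀ n, (V : EllTwo →L[ℂ] EllTwo) (f n • ellE n) = (W : EllTwo →L[ℂ] EllTwo) (f n • ellE n) := by
    intro n
    rw [map_smul, map_smul]
    congr 1
    exact h n
  simp_rw [e2] at h1
  exact h1.unique h2

/-- Agreement on the domain is needed only at the basis vectors, whose span is dense. -/
theorem hermiteJ_group_unique {V W : ℝ → (EllTwo ≃ₗᵢ[ℂ] EllTwo)} (hV : IsUnitaryGroupOf hermiteJ V)
    (hW : IsUnitaryGroupOf hermiteJ W) : V = W := by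
  funext t
  exact linearIsometryEquiv_ext_ellE fun n => hV.apply_eq hW (ellE_mem_graph n) t

/-! ### Multiplication by `e^{-itx}` -/

theorem norm_sq_eq_integral (u : LTwo) : ‖u‖ ^ 2 = ∫ x : ℝ, ‖u x‖ ^ 2 := by
  have h := inner_self_eq_norm_sq_to_K (𝕜 := ℂ) u
  rw [L2.inner_def] at h
  simp_rw [inner_self_eq_norm_sq_to_K] at h
  have e : ∀ x : ℝ, ((‖u x‖ : ℝ) : ℂ) ^ 2 = ((‖u x‖ ^ 2 : ℝ) : ℂ) := by
    intro x
    push_cast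
    rfl
  simp only [Complex.coe_algebraMap] at h
  simp_rw [e] at h
  rw [integral_complex_ofReal] at h
  exact_mod_cast h.symm

/-- Dominated convergence for the integrals of |F i - U₀|², with majorant (2w)². It serves both
strong continuity and the generator limit. -/
theorem tendsto_LTwo_of_dominated {ι : Type*} {l : Filter ι} [l.IsCountablyGenerated]
    {U : ι → LTwo} {U₀ : LTwo} {F : ι → ℝ → ℂ} {w : ℝ → ℝ} (hU : ∀ i, U i =ᵐ[volume] F i)
    (hw : MemLp w 2 (volume : Measure ℝ)) (hb : ∀ i, ∀ᵐ x, ‖F i x‖ ≤ w x)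
    (hb₀ : ∀ᵐ x, ‖U₀ x‖ ≤ w x)
    (hlim : ∀ᵐ x, Tendsto (fun i => F i x) l (𝓝 (U₀ x))) : Tendsto U l (𝓝 U₀) := by
  rw [tendsto_iff_norm_sub_tendsto_zero]
  have hsq : Tendsto (fun i => ‖U i - U₀‖ ^ 2) l (𝓝 0) := by
    have hn : ∀ i, ‖U i - U₀‖ ^ 2 = ∫ x : ℝ, ‖F i x - U₀ x‖ ^ 2 := by
      intro i
      rw [norm_sq_eq_integral]
      refine integral_congr_ae ?_
      filter_upwards [hU i, Lp.coeFn_sub (U i) U₀] with x h1 h2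
      rw [h2, Pi.sub_apply, h1]
    simp_rw [hn]
    have h0 : (0 : ℝ) = ∫ _x : ℝ, (0 : ℝ) := by simp
    rw [h0]
    refine tendsto_integral_filter_of_dominated_convergence (fun x => (2 * w x) ^ 2)
      (Eventually.of_forall fun i => ?_) (Eventually.of_forall fun i => ?_)
      (hw.const_mul 2).integrable_sq ?_
    · have : AEStronglyMeasurable (F i) := (Lp.aestronglyMeasurable (U i)).congr (hU i)
      exact (this.sub (Lp.aestronglyMeasurable U₀)).norm.pow 2
    · filter_upwards [hb i, hb₀] with x h1 h2
      rw [norm_pow, norm_norm]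
      gcongr
      linarith [norm_sub_le (F i x) (U₀ x)]
    · filter_upwards [hlim] with x hx
      have := ((tendsto_iff_norm_sub_tendsto_zero.1 hx).pow 2)
      simpa using this
  have := (Real.continuous_sqrt.tendsto 0).comp hsq
  simpa [Function.comp_def, Real.sqrt_sq (norm_nonneg _)] using this

theorem norm_phase (t x : ℝ) : ‖Complex.exp (-(Complex.I * t * x))‖ = 1 := by
  rw [Complex.norm_exp]
  simp

theorem memLp_phase_mul (t : ℝ) (u : LTwo) :
    MemLp (fun x : ℝ => Complex.exp (-(Complex.I * t * x)) * u x) 2 (volume : Measure ℝ) := by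
  have hc : Continuous fun x : ℝ => Complex.exp (-(Complex.I * t * x)) := by fun_prop
  refine (Lp.memLp u).of_le (hc.aestronglyMeasurable.mul (Lp.aestronglyMeasurable u))
    (ae_of_all _ fun x => ?_)
  rw [norm_mul, norm_phase, one_mul]

/-- Multiplication by `e^{-itx}` as a function on `L²(ℝ)`. -/
def phaseFun (t : ℝ) (u : LTwo) : LTwo := (memLp_phase_mul t u).toLp _

theorem phaseFun_ae (t : ℝ) (u : LTwo) :
    phaseFun t u =ᵐ[volume] fun x : ℝ => Complex.exp (-(Complex.I * t * x)) * u x :=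
  (memLp_phase_mul t u).coeFn_toLp

theorem phaseFun_add_left (s t : ℝ) (u : LTwo) :
    phaseFun (s + t) u = phaseFun s (phaseFun t u) := by
  apply Lp.ext
  filter_upwards [phaseFun_ae (s + t) u, phaseFun_ae s (phaseFun t u), phaseFun_ae t u] with x h1 h2 h3
  rw [h1, h2, h3, ← mul_assoc, ← Complex.exp_add]
  congr 2
  push_cast
  ring

theorem phaseFun_zero (u : LTwo) : phaseFun 0 u = u := by
  apply Lp.ext
  filter_upwards [phaseFun_ae 0 u] with x h1
  rw [h1]
  simp

/-- Multiplication by `e^{-itx}` as a unitary operator in `L²(ℝ)`. -/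
def phaseMul (t : ℝ) : LTwo ≃ₗᵢ[ℂ] LTwo where
  toFun := phaseFun t
  invFun := phaseFun (-t)
  left_inv u := by rw [← phaseFun_add_left, neg_add_cancel, phaseFun_zero]
  right_inv u := by rw [← phaseFun_add_left, add_neg_cancel, phaseFun_zero]
  map_add' u v := by
    apply Lp.ext
    filter_upwards [phaseFun_ae t (u + v), phaseFun_ae t u, phaseFun_ae t v, Lp.coeFn_add u v,
      Lp.coeFn_add (phaseFun t u) (phaseFun t v)] with x h1 h2 h3 h4 h5
    rw [h1, h5, Pi.add_apply, h2, h3, h4, Pi.add_apply, mul_add]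
  map_smul' c u := by
    apply Lp.ext
    filter_upwards [phaseFun_ae t (c • u), phaseFun_ae t u, Lp.coeFn_smul c u,
      Lp.coeFn_smul c (phaseFun t u)] with x h1 h2 h3 h4
    simp only [RingHom.id_apply]
    rw [h1, h4, Pi.smul_apply, h2, h3, Pi.smul_apply, smul_eq_mul, smul_eq_mul]
    ring
  norm_map' u := by
    change ‖phaseFun t u‖ = ‖u‖
    rw [← sq_eq_sq₀ (norm_nonneg _) (norm_nonneg _), norm_sq_eq_integral, norm_sq_eq_integral]
    refine integral_congr_ae ?_
    filter_upwards [phaseFun_ae t u] with x h1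
    rw [h1, norm_mul, norm_phase, one_mul]

theorem phaseMul_ae (t : ℝ) (u : LTwo) :
    phaseMul t u =ᵐ[volume] fun x : ℝ => Complex.exp (-(Complex.I * t * x)) * u x :=
  phaseFun_ae t u

theorem continuous_phaseMul (u : LTwo) : Continuous fun t : ℝ => phaseMul t u := by
  rw [continuous_iff_continuousAt]
  intro t
  refine tendsto_LTwo_of_dominated (w := fun x => ‖u x‖) (fun s => phaseMul_ae s u) (Lp.memLp u).norm
    (fun s => ae_of_all _ fun x => ?_) ?_ ?_
  · rw [norm_mul, norm_phase, one_mul]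
  · filter_upwards [phaseMul_ae t u] with x hx
    rw [hx, norm_mul, norm_phase, one_mul]
  · filter_upwards [phaseMul_ae t u] with x hx
    rw [hx]
    have : Continuous fun s : ℝ => Complex.exp (-(Complex.I * s * x)) * u x := by fun_prop
    exact this.tendsto t

theorem norm_phase_sub_one_le (t x : ℝ) : ‖Complex.exp (-(Complex.I * t * x)) - 1‖ ≤ |t| * |x| := by
  have := Real.norm_exp_I_mul_ofReal_sub_one_le (x := -(t * x))
  rw [norm_neg, norm_mul] at this
  refine le_trans (le_of_eq ?_) this
  congr 3
  push_cast
  ring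

theorem tendsto_phase_slope (x : ℝ) :
    Tendsto (fun t : ℝ => Complex.I / (t : ℂ) * (Complex.exp (-(Complex.I * t * x)) - 1)) (𝓝[≠] 0)
      (𝓝 (x : ℂ)) := by
  have h1 : HasDerivAt (fun t : ℝ => -(Complex.I * t * x)) (-(Complex.I * x)) 0 := by
    have := ((Complex.ofRealCLM.hasDerivAt (x := (0 : ℝ))).const_mul Complex.I).mul_const (x : ℂ)
    simpa using! this.neg
  have h2 := h1.cexp
  rw [hasDerivAt_iff_tendsto_slope_zero] at h2
  have h3 := h2.const_mul Complex.I
  have e : Complex.I * (Complex.exp (-(Complex.I * ((0 : ℝ) : ℂ) * x)) * -(Complex.I * x)) = x := by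
    simp only [Complex.ofReal_zero, mul_zero, zero_mul, neg_zero, Complex.exp_zero, one_mul]
    linear_combination (-(x : ℂ)) * Complex.I_mul_I
  rw [e] at h3
  refine h3.congr fun t => ?_
  simp only [zero_add, Complex.real_smul]
  push_cast
  simp
  ring

theorem tendsto_phaseMul_slope {u v : LTwo} (h : ∀ᵐ x : ℝ, (x : ℂ) * u x = v x) :
    Tendsto (fun t : ℝ => (Complex.I / (t : ℂ)) • (phaseMul t u - u)) (𝓝[≠] 0) (𝓝 v) := by
  refine tendsto_LTwo_of_dominated (w := fun x => ‖v x‖)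
    (F := fun t x => Complex.I / (t : ℂ) * (Complex.exp (-(Complex.I * t * x)) - 1) * u x)
    (fun t => ?_) (Lp.memLp v).norm (fun t => ?_) (ae_of_all _ fun x => le_rfl) ?_
  · filter_upwards [phaseMul_ae t u, Lp.coeFn_sub (phaseMul t u) u,
      Lp.coeFn_smul (Complex.I / (t : ℂ)) (phaseMul t u - u)] with x h1 h2 h3
    rw [h3, Pi.smul_apply, h2, Pi.sub_apply, h1, smul_eq_mul]
    ring
  · filter_upwards [h] with x hx
    rw [← hx, norm_mul, norm_mul, norm_mul, norm_div, Complex.norm_I, Complex.norm_real,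
      Complex.norm_real, Real.norm_eq_abs, Real.norm_eq_abs]
    gcongr
    -- The bound is required for every t; at t = 0 division by zero gives the value 0.
    rcases eq_or_ne t 0 with rfl | ht
    · simp
    · have := norm_phase_sub_one_le t x
      have ht' : 0 < |t| := abs_pos.2 ht
      rw [one_div, inv_mul_le_iff₀ ht']
      exact this
  · filter_upwards [h] with x hx
    rw [← hx]
    exact (tendsto_phase_slope x).mul_const _

/-! ### The group generated by the Hermite operator -/

/-- The unitary group `e^{-iJt}` of the Hermite operator. -/
def hermiteGroup (t : ℝ) : EllTwo ≃ₗᵢ[ℂ] EllTwo :=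
  (hermitePhiEquiv.trans (phaseMul t)).trans hermitePhiEquiv.symm

theorem hermiteGroup_apply (t : ℝ) (f : EllTwo) :
    hermiteGroup t f = hermitePhiEquiv.symm (phaseMul t (hermitePhiEquiv f)) := rfl

theorem hermiteGroup_add (s t : ℝ) (f : EllTwo) :
    hermiteGroup (s + t) f = hermiteGroup s (hermiteGroup t f) := by
  simp only [hermiteGroup_apply, LinearIsometryEquiv.apply_symm_apply]
  congr 1
  exact phaseFun_add_left s t _

theorem hermiteGroup_zero (f : EllTwo) : hermiteGroup 0 f = f := by
  have : phaseMul 0 (hermitePhiEquiv f) = hermitePhiEquiv f := phaseFun_zero _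
  rw [hermiteGroup_apply, this, LinearIsometryEquiv.symm_apply_apply]

theorem tendsto_hermiteGroup_slope {f h : EllTwo} (hfh : (f, h) ∈ hermiteJ.graph) :
    Tendsto (fun t : ℝ => (Complex.I / (t : ℂ)) • (hermiteGroup t f - f)) (𝓝[≠] 0) (𝓝 h) := by
  have h1 := tendsto_phaseMul_slope (hermitePhiEquiv_of_jacobiSeq (mem_graph_hermiteJ.1 hfh))
  have h2 := (hermitePhiEquiv.symm.continuous.tendsto _).comp h1
  rw [LinearIsometryEquiv.symm_apply_apply] at h2
  refine h2.congr fun t => ?_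
  simp only [Function.comp_apply, map_smul, map_sub, LinearIsometryEquiv.symm_apply_apply,
    hermiteGroup_apply]

theorem inner_hermiteGroup (t : ℝ) (f g : EllTwo) :
    inner ℂ f (hermiteGroup t g) = inner ℂ (hermiteGroup (-t) f) g := by
  rw [← LinearIsometryEquiv.inner_map_map (hermiteGroup t) (hermiteGroup (-t) f) g,
    ← hermiteGroup_add, add_neg_cancel, hermiteGroup_zero]

theorem isUnitaryGroupOf_hermiteGroup : IsUnitaryGroupOf hermiteJ hermiteGroup where
  map_zero := hermiteGroup_zero
  map_add := hermiteGroup_add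
  strong_continuous f := hermitePhiEquiv.symm.continuous.comp (continuous_phaseMul _)
  generator f h := by
    refine ⟨tendsto_hermiteGroup_slope, fun hlim => mem_graph_hermiteJ.2 fun n => ?_⟩
    -- Maximality of the domain: the adjoint of the difference quotient at t is the one at -t.
    -- Pairing with e_n and moving the quotient onto e_n, which is in the domain, identifies the
    -- n-th coordinate of the limit with ⟨J e_n, f⟩ = (Jf)_n.
    have h1 : Tendsto (fun t : ℝ => inner ℂ (ellE n) ((Complex.I / (t : ℂ)) • (hermiteGroup t f - f)))
        (𝓝[≠] 0) (𝓝 (inner ℂ (ellE n) h)) := tendsto_const_nhds.inner hlim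
    have hneg : Tendsto (fun t : ℝ => -t) (𝓝[≠] 0) (𝓝[≠] 0) := by
      have h0 : Tendsto (fun t : ℝ => -t) (𝓝 0) (𝓝 0) := by
        simpa using (continuous_neg (G := ℝ)).tendsto 0
      refine tendsto_nhdsWithin_iff.2 ⟨h0.mono_left nhdsWithin_le_nhds, ?_⟩
      filter_upwards [self_mem_nhdsWithin] with t ht
      simpa using ht
    have h2 : Tendsto (fun t : ℝ => inner ℂ ((Complex.I / ((-t : ℝ) : ℂ)) •
        (hermiteGroup (-t) (ellE n) - ellE n)) f) (𝓝[≠] 0) (𝓝 (inner ℂ (hermiteJE n) f)) :=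
      ((tendsto_hermiteGroup_slope (ellE_mem_graph n)).comp hneg).inner tendsto_const_nhds
    rw [inner_ellE] at h1
    rw [inner_hermiteJE] at h2
    refine tendsto_nhds_unique h1 (h2.congr fun t => ?_)
    rw [inner_smul_left, inner_smul_right, inner_sub_left, inner_sub_right, inner_hermiteGroup]
    congr 1
    simp

theorem hermiteGroup_coeff (t : ℝ) (f : EllTwo) {g : ℝ → ℂ}
    (hg : (hermitePhi f : ℝ → ℂ) =ᵐ[volume] g) (n : ℕ) :
    hermiteGroup t f n =
      ∫ x : ℝ, (hermiteFun n x : ℂ) * (Complex.exp (-(Complex.I * t * x)) * g x) := by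
  rw [hermiteGroup_apply, hermitePhiEquiv_symm_apply]
  refine integral_congr_ae ?_
  rw [← hermitePhiEquiv_apply] at hg
  filter_upwards [phaseMul_ae t (hermitePhiEquiv f), hg] with x h1 h2
  rw [h1, h2]

/-! ### Asymptotics of the group -/

/-- One integration by parts; first-order decay is all that the estimates use. -/
theorem exists_abs_mul_norm_fourierHat_le {g : ℝ → ℂ} (hg : ContDiff ℝ (⊤ : ℕ∞) g)
    (hc : HasCompactSupport g) : ∃ C, 0 ≤ C ∧ ∀ x : ℝ, |x| * ‖fourierHat g x‖ ≤ C := by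
  have hπ : 0 < (Real.sqrt (2 * Real.pi))⁻¹ := inv_pos.2 (Real.sqrt_pos.2 (by positivity))
  refine ⟨(Real.sqrt (2 * Real.pi))⁻¹ * ∫ y, ‖deriv g y‖, ?_, fun x => ?_⟩
  · have : 0 ≤ ∫ y, ‖deriv g y‖ := integral_nonneg fun _ => norm_nonneg _
    positivity
  have hE : Continuous fun y : ℝ => Complex.exp (-(Complex.I * x * y)) := by fun_prop
  have hdc : Continuous (deriv g) := hg.continuous_deriv (by simp)
  have i0 : Integrable fun y : ℝ => Complex.exp (-(Complex.I * x * y)) * g y :=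
    (hE.mul hg.continuous).integrable_of_hasCompactSupport hc.mul_left
  have i1 : Integrable fun y : ℝ => Complex.exp (-(Complex.I * x * y)) * deriv g y :=
    (hE.mul hdc).integrable_of_hasCompactSupport hc.deriv.mul_left
  have hd : ∀ y : ℝ, HasDerivAt (fun y : ℝ => Complex.exp (-(Complex.I * x * y)) * g y)
      (Complex.exp (-(Complex.I * x * y)) * deriv g y
        - Complex.I * x * (Complex.exp (-(Complex.I * x * y)) * g y)) y := by
    intro y
    have h1 : HasDerivAt (fun y : ℝ => -(Complex.I * x * y)) (-(Complex.I * x)) y := by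
      simpa using! ((Complex.ofRealCLM.hasDerivAt (x := y)).const_mul (Complex.I * x)).neg
    have h2 : HasDerivAt g (deriv g y) y := (hg.differentiable (by simp)).differentiableAt.hasDerivAt
    refine (h1.cexp.mul h2).congr_deriv ?_
    ring
  have h := integral_eq_zero_of_hasDerivAt_of_integrable hd (i1.sub (i0.const_mul _)) i0
  rw [integral_sub i1 (i0.const_mul _), integral_const_mul] at h
  have hn : |x| * ‖∫ y : ℝ, Complex.exp (-(Complex.I * x * y)) * g y‖ ≤ ∫ y, ‖deriv g y‖ := by
    calc |x| * ‖∫ y : ℝ, Complex.exp (-(Complex.I * x * y)) * g y‖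
        = ‖Complex.I * x * ∫ y : ℝ, Complex.exp (-(Complex.I * x * y)) * g y‖ := by
          rw [norm_mul, norm_mul, Complex.norm_I, one_mul, Complex.norm_real, Real.norm_eq_abs]
      _ = ‖∫ y : ℝ, Complex.exp (-(Complex.I * x * y)) * deriv g y‖ := by rw [← sub_eq_zero.1 h]
      _ ≤ ∫ y : ℝ, ‖Complex.exp (-(Complex.I * x * y)) * deriv g y‖ := norm_integral_le_integral_norm _
      _ = ∫ y, ‖deriv g y‖ := by
          congr 1
          ext y
          rw [norm_mul, norm_phase, one_mul]
  unfold fourierHat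
  rw [norm_mul, ← Complex.ofReal_inv, Complex.norm_real, Real.norm_of_nonneg hπ.le, mul_left_comm]
  gcongr

theorem tendsto_fourierHat {g : ℝ → ℂ} (hg : ContDiff ℝ (⊤ : ℕ∞) g) (hc : HasCompactSupport g)
    {ι : Type*} {l : Filter ι} {a : ι → ℝ} (ha : Tendsto (fun i => |a i|) l atTop) :
    Tendsto (fun i => fourierHat g (a i)) l (𝓝 0) := by
  obtain ⟨C, -, hC⟩ := exists_abs_mul_norm_fourierHat_le hg hc
  have h0 : Tendsto (fun i => |a i|⁻¹ * C) l (𝓝 0) := by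
    simpa using (tendsto_inv_atTop_zero.comp ha).mul_const C
  refine squeeze_zero_norm' ?_ h0
  filter_upwards [ha.eventually_gt_atTop 0] with i hi
  rw [le_inv_mul_iff₀ hi]
  exact hC _

/-- The exponentials e^{±iνx} shift the frequency t to t ∓ ν. The two resulting terms are the two
branches of `hermiteU`. -/
theorem integral_hermiteWave_mul {g : ℝ → ℂ} (hg : Continuous g) (hc : HasCompactSupport g)
    (n : ℕ) (t : ℝ) :
    ∫ x : ℝ, hermiteWave n x * (Complex.exp (-(Complex.I * t * x)) * g x) =
      Complex.I ^ (-(n : ℤ)) * (hermiteScale n : ℂ) * fourierHat g (t - Real.sqrt (2 * (n : ℝ) + 1)) +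
      Complex.I ^ (n : ℤ) * (hermiteScale n : ℂ) * fourierHat g (t + Real.sqrt (2 * (n : ℝ) + 1)) := by
  set ν := Real.sqrt (2 * (n : ℝ) + 1)
  have hi : ∀ s : ℝ, Integrable fun x : ℝ => Complex.exp (-(Complex.I * s * x)) * g x := by
    intro s
    have hE : Continuous fun y : ℝ => Complex.exp (-(Complex.I * s * y)) := by fun_prop
    exact (hE.mul hg).integrable_of_hasCompactSupport hc.mul_left
  have e : ∀ x : ℝ, hermiteWave n x * (Complex.exp (-(Complex.I * t * x)) * g x) =
      Complex.I ^ (-(n : ℤ)) * (hermiteScale n : ℂ) * ((Real.sqrt (2 * Real.pi))⁻¹ : ℂ) *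
        (Complex.exp (-(Complex.I * ((t - ν : ℝ) : ℂ) * x)) * g x) +
      Complex.I ^ (n : ℤ) * (hermiteScale n : ℂ) * ((Real.sqrt (2 * Real.pi))⁻¹ : ℂ) *
        (Complex.exp (-(Complex.I * ((t + ν : ℝ) : ℂ) * x)) * g x) := by
    intro x
    have e1 : Complex.exp (-(Complex.I * ((t - ν : ℝ) : ℂ) * x)) =
        Complex.exp (Complex.I * ν * x) * Complex.exp (-(Complex.I * t * x)) := by
      rw [← Complex.exp_add]
      congr 1
      push_cast
      ring
    have e2 : Complex.exp (-(Complex.I * ((t + ν : ℝ) : ℂ) * x)) =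
        Complex.exp (-(Complex.I * ν * x)) * Complex.exp (-(Complex.I * t * x)) := by
      rw [← Complex.exp_add]
      congr 1
      push_cast
      ring
    rw [e1, e2, hermiteWave]
    ring
  simp_rw [e]
  rw [integral_add ((hi _).const_mul _) ((hi _).const_mul _), integral_const_mul, integral_const_mul]
  simp only [fourierHat]
  ring

/-! ### Coefficientwise error, uniformly in time, and passage to the limit. -/

theorem norm_zpow_I (k : ℤ) : ‖Complex.I ^ k‖ = 1 := by
  rw [norm_zpow, Complex.norm_I, one_zpow]

theorem summable_hermiteScale_pow_six : Summable fun n => hermiteScale n ^ 6 := by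
  have h : Summable fun n : ℕ => ((n : ℝ) + 1) ^ (-(3 / 2) : ℝ) := by
    have := (summable_nat_add_iff 1).2 (Real.summable_nat_rpow.2 (by norm_num : (-(3 / 2) : ℝ) < -1))
    simpa using this
  refine Summable.of_nonneg_of_le (fun n => by have := hermiteScale_pos n; positivity) (fun n => ?_) h
  have hn : (0 : ℝ) ≤ n := n.cast_nonneg
  have : hermiteScale n ^ 6 = (2 * (n : ℝ) + 1) ^ (-(3 / 2) : ℝ) := by
    rw [hermiteScale, ← Real.rpow_natCast, ← Real.rpow_mul (by positivity)]
    norm_num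
  rw [this]
  apply Real.rpow_le_rpow_of_nonpos (by positivity) (by linarith) (by norm_num)

/-- Two errors add up: replacing φ_n by the wave on the support of g, and dropping the branch of the
wave that `hermiteU` omits for the given sign of t. Independence of K from t is what later supplies
the summable majorant. -/
theorem exists_norm_coeff_sub_hermiteU_le {g : ℝ → ℂ} (hg : ContDiff ℝ (⊤ : ℕ∞) g)
    (hc : HasCompactSupport g) : ∃ K, 0 ≤ K ∧ ∀ (t : ℝ) (n : ℕ), t ≠ 0 →
    ‖(∫ x : ℝ, (hermiteFun n x : ℂ) * (Complex.exp (-(Complex.I * t * x)) * g x)) - hermiteU t g n‖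
      ≤ K * hermiteScale n ^ 3 := by
  obtain ⟨R, hR0, hR⟩ : ∃ R : ℝ, 0 ≤ R ∧ ∀ x, g x ≠ 0 → |x| ≤ R := by
    obtain ⟨R, hR⟩ := hc.isCompact.isBounded.exists_norm_le
    refine ⟨max R 0, le_max_right _ _, fun x hx => (hR x (subset_tsupport g hx)).trans (le_max_left _ _)⟩
  obtain ⟨C, hC0, hC⟩ := exists_norm_hermiteFun_sub_wave_le hR0
  obtain ⟨C', hC'0, hC'⟩ := exists_abs_mul_norm_fourierHat_le hg hc
  have hG : 0 ≤ ∫ x, ‖g x‖ := integral_nonneg fun _ => norm_nonneg _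
  refine ⟨C' + C * ∫ x, ‖g x‖, by positivity, fun t n ht => ?_⟩
  have hm := hermiteScale_pos n
  have hν := sqrt_mul_hermiteScale_sq n
  have hw := integral_hermiteWave_mul hg.continuous hc n t
  have hcw : Continuous (hermiteWave n) := by
    unfold hermiteWave
    fun_prop
  have hch : Continuous fun x => (hermiteFun n x : ℂ) :=
    Complex.continuous_ofReal.comp (continuous_hermiteFun n)
  have hE : Continuous fun y : ℝ => Complex.exp (-(Complex.I * t * y)) := by fun_prop
  have hrem : ‖(∫ x : ℝ, (hermiteFun n x : ℂ) * (Complex.exp (-(Complex.I * t * x)) * g x)) -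
      ∫ x : ℝ, hermiteWave n x * (Complex.exp (-(Complex.I * t * x)) * g x)‖ ≤
      C * hermiteScale n ^ 3 * ∫ x, ‖g x‖ := by
    have hi : ∀ w : ℝ → ℂ, Continuous w →
        Integrable fun x : ℝ => w x * (Complex.exp (-(Complex.I * t * x)) * g x) := fun w h =>
      (h.mul (hE.mul hg.continuous)).integrable_of_hasCompactSupport hc.mul_left.mul_left
    rw [← integral_sub (hi _ hch) (hi _ hcw), ← integral_const_mul]
    refine norm_integral_le_of_norm_le
      ((hg.continuous.integrable_of_hasCompactSupport hc).norm.const_mul _) (ae_of_all _ fun x => ?_)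
    rw [← sub_mul, norm_mul, norm_mul, norm_phase, one_mul]
    by_cases hx : g x = 0
    · simp [hx]
    · have := hC n x (hR x hx)
      gcongr
  -- When |s| ≥ ν the decay of ĝ gains 1/ν = m² over the prefactor m.
  have hfar : ∀ (s : ℝ) (k : ℤ), Real.sqrt (2 * (n : ℝ) + 1) ≤ |s| →
      ‖Complex.I ^ k * (hermiteScale n : ℂ) * fourierHat g s‖ ≤ C' * hermiteScale n ^ 3 := by
    intro s k hs
    rw [norm_mul, norm_mul, norm_zpow_I, one_mul, Complex.norm_real, Real.norm_of_nonneg hm.le]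
    have h1 := hC' s
    have h2 : Real.sqrt (2 * (n : ℝ) + 1) * ‖fourierHat g s‖ ≤ C' :=
      (mul_le_mul_of_nonneg_right hs (norm_nonneg _)).trans h1
    calc hermiteScale n * ‖fourierHat g s‖ =
        hermiteScale n ^ 3 * (Real.sqrt (2 * (n : ℝ) + 1) * ‖fourierHat g s‖) := by
          linear_combination (-hermiteScale n * ‖fourierHat g s‖) * hν
      _ ≤ hermiteScale n ^ 3 * C' := by gcongr
      _ = _ := mul_comm _ _
  have hν0 := Real.sqrt_nonneg (2 * (n : ℝ) + 1)
  have hsplit : ‖(∫ x : ℝ, hermiteWave n x * (Complex.exp (-(Complex.I * t * x)) * g x))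
      - hermiteU t g n‖ ≤ C' * hermiteScale n ^ 3 := by
    rw [hw, hermiteU]
    split_ifs with h
    · change ‖Complex.I ^ (-(n : ℤ)) * (hermiteScale n : ℂ) * fourierHat g _ + _ -
        Complex.I ^ (-(n : ℤ)) * (hermiteScale n : ℂ) * fourierHat g _‖ ≤ _
      rw [add_sub_cancel_left]
      apply hfar
      rw [abs_of_nonneg (by positivity)]
      linarith
    · change ‖_ + Complex.I ^ (n : ℤ) * (hermiteScale n : ℂ) * fourierHat g _ -
        Complex.I ^ (n : ℤ) * (hermiteScale n : ℂ) * fourierHat g _‖ ≤ _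
      rw [add_sub_cancel_right]
      apply hfar
      rw [abs_of_nonpos (by linarith)]
      linarith
  calc _ ≤ C * hermiteScale n ^ 3 * (∫ x, ‖g x‖) + C' * hermiteScale n ^ 3 :=
        (norm_sub_le_norm_sub_add_norm_sub _ _ _).trans (add_le_add hrem hsplit)
    _ = _ := by ring

/-- Up to the factor √(2π) the integral is the Fourier transform at t of the test function φ_n g.
The condition on l covers both t → +∞ and t → -∞. -/
theorem tendsto_coeff {g : ℝ → ℂ} (hg : ContDiff ℝ (⊤ : ℕ∞) g) (hc : HasCompactSupport g)
    {l : Filter ℝ} (hl : ∀ c : ℝ, Tendsto (fun t => |t + c|) l atTop) (n : ℕ) :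
    Tendsto (fun t : ℝ => ∫ x : ℝ, (hermiteFun n x : ℂ) * (Complex.exp (-(Complex.I * t * x)) * g x))
      l (𝓝 0) := by
  have h1 : ContDiff ℝ (⊤ : ℕ∞) fun x => (hermiteFun n x : ℂ) * g x :=
    (Complex.ofRealCLM.contDiff.comp (contDiff_hermiteFun n)).mul hg
  have h2 := (tendsto_fourierHat h1 hc.mul_left (a := fun t : ℝ => t) (by simpa using hl 0)).const_mul
    (Real.sqrt (2 * Real.pi) : ℂ)
  rw [mul_zero] at h2
  refine h2.congr fun t => ?_
  have hπ : (Real.sqrt (2 * Real.pi) : ℂ) ≠ 0 := by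
    exact_mod_cast (Real.sqrt_pos.2 (by positivity)).ne'
  rw [fourierHat, mul_inv_cancel_left₀ hπ]
  congr 1
  ext x
  ring

theorem tendsto_hermiteU {g : ℝ → ℂ} (hg : ContDiff ℝ (⊤ : ℕ∞) g) (hc : HasCompactSupport g)
    {l : Filter ℝ} (hl : ∀ c : ℝ, Tendsto (fun t => |t + c|) l atTop) (n : ℕ) :
    Tendsto (fun t : ℝ => hermiteU t g n) l (𝓝 0) := by
  have h1 := tendsto_fourierHat hg hc (hl (-Real.sqrt (2 * (n : ℝ) + 1)))
  have h2 := tendsto_fourierHat hg hc (hl (Real.sqrt (2 * (n : ℝ) + 1)))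
  -- The sum of both branches bounds either one, so the sign of t plays no role.
  refine squeeze_zero_norm (fun t => ?_) (by simpa using h1.norm.add h2.norm)
  have hm := hermiteScale_pos n
  have hm1 := hermiteScale_le_one n
  have hb : ∀ (k : ℤ) (z : ℂ), ‖Complex.I ^ k * (hermiteScale n : ℂ) * z‖ ≤ ‖z‖ := by
    intro k z
    rw [norm_mul, norm_mul, norm_zpow_I, one_mul, Complex.norm_real, Real.norm_of_nonneg hm.le]
    exact mul_le_of_le_one_left (norm_nonneg _) hm1
  rw [hermiteU, ← sub_eq_add_neg]
  split_ifs
  · exact (hb _ _).trans (le_add_of_nonneg_right (norm_nonneg _))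
  · exact (hb _ _).trans (le_add_of_nonneg_left (norm_nonneg _))

theorem ellTwo_norm_sq (f : EllTwo) : ‖f‖ ^ 2 = ∑' n, ‖f n‖ ^ 2 := by
  have := lp.norm_rpow_eq_tsum (p := 2) (by norm_num) f
  simpa using this

theorem tendsto_norm_of_coeff {l : Filter ℝ} {F : ℝ → EllTwo} {b : ℕ → ℝ} (hb : Summable b)
    (hle : ∀ᶠ t in l, ∀ n, ‖F t n‖ ^ 2 ≤ b n) (hlim : ∀ n, Tendsto (fun t => F t n) l (𝓝 0)) :
    Tendsto (fun t => ‖F t‖) l (𝓝 0) := by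
  have h : Tendsto (fun t => ∑' n, ‖F t n‖ ^ 2) l (𝓝 (∑' _n : ℕ, (0 : ℝ))) := by
    refine tendsto_tsum_of_dominated_convergence hb (fun n => ?_) ?_
    · simpa using (hlim n).norm.pow 2
    · filter_upwards [hle] with t ht n
      rw [norm_pow, norm_norm]
      exact ht n
  simp_rw [← ellTwo_norm_sq] at h
  rw [tsum_zero] at h
  have := (Real.continuous_sqrt.tendsto 0).comp h
  simpa [Function.comp_def, Real.sqrt_sq (norm_nonneg _)] using this

theorem hermiteGroup_asymptotics {f : EllTwo} {g : ℝ → ℂ} (hg : ContDiff ℝ (⊤ : ℕ∞) g)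
    (hc : HasCompactSupport g) (hfg : (hermitePhi f : ℝ → ℂ) =ᵐ[volume] g) :
    ∃ u : ℝ → EllTwo, (∀ t : ℝ, t ≠ 0 → ∀ n : ℕ, u t n = hermiteU t g n) ∧
      Tendsto (fun t : ℝ => ‖hermiteGroup t f - u t‖) atTop (𝓝 0) ∧
      Tendsto (fun t : ℝ => ‖hermiteGroup t f - u t‖) atBot (𝓝 0) := by
  obtain ⟨K, hK0, hK⟩ := exists_norm_coeff_sub_hermiteU_le hg hc
  have hb : Summable fun n => K ^ 2 * hermiteScale n ^ 6 := summable_hermiteScale_pow_six.mul_left _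
  have hle : ∀ t : ℝ, t ≠ 0 → ∀ n, ‖hermiteGroup t f n - hermiteU t g n‖ ^ 2 ≤
      K ^ 2 * hermiteScale n ^ 6 := by
    intro t ht n
    rw [hermiteGroup_coeff t f hfg n]
    calc _ ≤ (K * hermiteScale n ^ 3) ^ 2 := by
          gcongr
          exact hK t n ht
      _ = _ := by ring
  -- U(t)g is a vector of ℓ² minus a sequence whose squares have a summable majorant.
  have hmem : ∀ t : ℝ, t ≠ 0 → Memℓp (hermiteU t g) 2 := by
    intro t ht
    have hd : Memℓp (fun n => hermiteGroup t f n - hermiteU t g n) 2 := by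
      apply memℓp_gen
      refine Summable.of_nonneg_of_le (fun n => by positivity) (fun n => ?_) hb
      simpa using hle t ht n
    have := (lp.memℓp (hermiteGroup t f)).sub hd
    convert this using 1
    funext n
    simp
  refine ⟨fun t => if h : t = 0 then 0 else ⟨hermiteU t g, hmem t h⟩, fun t ht n => by simp [ht], ?_⟩
  have key : ∀ l : Filter ℝ, (∀ c : ℝ, Tendsto (fun t => |t + c|) l atTop) →
      Tendsto (fun t : ℝ => ‖hermiteGroup t f -
        (if h : t = 0 then 0 else ⟨hermiteU t g, hmem t h⟩ : EllTwo)‖) l (𝓝 0) := by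
    intro l hl
    have hne : ∀ᶠ t in l, t ≠ 0 := by
      filter_upwards [(hl 0).eventually_gt_atTop 0] with t ht
      simpa using ht
    refine tendsto_norm_of_coeff hb ?_ fun n => ?_
    · filter_upwards [hne] with t ht n
      simp only [dif_neg ht]
      exact hle t ht n
    · have h1 := (tendsto_coeff hg hc hl n).sub (tendsto_hermiteU hg hc hl n)
      rw [sub_zero] at h1
      refine h1.congr' ?_
      filter_upwards [hne] with t ht
      simp only [dif_neg ht]
      rw [← hermiteGroup_coeff t f hfg n]
      rfl
  exact ⟨key _ fun c => tendsto_abs_atTop_atTop.comp (tendsto_atTop_add_const_right _ c tendsto_id),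
    key _ fun c => tendsto_abs_atBot_atTop.comp (tendsto_atBot_add_const_right _ c tendsto_id)⟩

end

/-- The Hermite operator `J` generates exactly one unitary group `e^{-iJt}`, and whenever
`Φ f = g ∈ C₀^∞(ℝ)`, the sequences `U(t) g` are in `ℓ²(ℤ₊)` and
`‖e^{-iJt} f - U(t) g‖ → 0` as `t → ±∞`. -/
theorem theorem7 :
    (∃! W : ℝ → (EllTwo ≃ₗᵢ[ℂ] EllTwo), IsUnitaryGroupOf hermiteJ W) ∧
    ∀ W : ℝ → (EllTwo ≃ₗᵢ[ℂ] EllTwo), IsUnitaryGroupOf hermiteJ W →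
    ∀ (f : EllTwo) (g : ℝ → ℂ), ContDiff ℝ (⊤ : ℕ∞) g → HasCompactSupport g →
      (hermitePhi f : ℝ → ℂ) =ᵐ[volume] g →
      ∃ u : ℝ → EllTwo, (∀ t : ℝ, t ≠ 0 → ∀ n : ℕ, u t n = hermiteU t g n) ∧
        Tendsto (fun t : ℝ => ‖W t f - u t‖) atTop (𝓝 0) ∧
        Tendsto (fun t : ℝ => ‖W t f - u t‖) atBot (𝓝 0) := by
  refine ⟨⟨hermiteGroup, isUnitaryGroupOf_hermiteGroup, fun W hW =>
    hermiteJ_group_unique hW isUnitaryGroupOf_hermiteGroup⟩, fun W hW f g hg hc hfg => ?_⟩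
  rw [hermiteJ_group_unique hW isUnitaryGroupOf_hermiteGroup]
  exact hermiteGroup_asymptotics hg hc hfg
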